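/- Let $M$ be a smooth $n$-dimensional manifold without boundary (Hausdorff and $\sigma$-compact, not necessarily connected), and let $P$ be a continuous fibre seminorm on $T^*M$, that is, $P:T^*M\to[0,\infty)$ is continuous and restricts to a seminorm $P_x$ on each fibre $T_x^*M$. Put $P^*_x(v)=\sup\{|\xi(v)| : \xi\in T_x^*M,\ P(\xi)\le 1\}\in[0,\infty]$ for $v\in T_xM$, and call $v$ $P$-subunit if $P^*(v)\le 1$. A $P$-subunit vector field is a smooth vector field all of whose values are $P$-subunit. A curve $\gamma:[a,b]\to M$ is $P$-subunit if it is absolutely continuous and $\gamma'(t)$ is $P$-subunit for almost every $t$; it is a $P$-subunit piecewise flow curve if it is a finite concatenation of flow curves of $P$-subunit vector fields on $M$. Let $\varrho_P(x,y)$, $\varrho_P^\infty(x,y)$ and $\varrho_P^{\mathrm{flow}}(x,y)$ in $[0,\infty]$ be the infimum of all $T>0$ for which there is, respectively, a $P$-subunit curve, a smooth $P$-subunit curve, or a $P$-subunit piecewise flow curve $\gamma:[0,T]\to M$ with $\gamma(0)=x$ and $\gamma(T)=y$. An extended distance is called varietal if it induces the manifold topology. The $P$-length of a continuous curve $\gamma:[a,b]\to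 M$ is $\ell_P(\gamma)=\sup\sum_{j=1}^m\varrho_P(\gamma(t_{j-1}),\gamma(t_j))$, the supremum being over all subdivisions $a=t_0\le\dots\le t_m=b$. Suppose that $P$ satisfies the Lipschitz seminorm condition: there is a countable locally finite atlas of smooth charts $\varphi_\alpha:U_\alpha\to\mathbb R^n$, each onto $\mathbb R^n$, such that the sets $V_\alpha=\varphi_\alpha^{-1}(B_{\mathbb R^n}(0,1))$ cover $M$ and, for each $\alpha$, there are a countable family $\mathfrak X$ of $P$-subunit vector fields on $U_\alpha$ and a constant $L$ (which may depend on $\alpha$) such that (i) the coordinate expression of each $X\in\mathfrak X$ in the chart $\varphi_\alpha$ is $L$-Lipschitz on $B_{\mathbb R^n}(0,1)$, and (ii) for each $x\in V_\alpha$ the closure of $\{X|_x : X\in\mathfrak X\}$ is $\{v\in T_xM : P^*(v)\le 1\}$. Then: 1. For all $x,y\in M$ with $x\ne y$, $$\varrho_P(x,y)\ \ge\ \liminf_{z\to y}\varrho_P^{\mathrm{flow}}(x,z),$$ where $z\to y$ with $z\neq y$. 2. If $\varrho_P^{\mathrm{flow}}$ is varietal, then $\varrho_P=\varrho_P^{\mathrm{flow}}$.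 3. If $\varrho_P^\infty$ is varietal, then $\varrho_P=\varrho_P^\infty$, and for all $a<b$ and all $x,y\in M$ both $\varrho_P(x,y)$ and $\varrho_P^\infty(x,y)$ are equal to $$\inf\{\ell_P(\gamma) : \gamma:[a,b]\to M\text{ smooth},\ \gamma(a)=x,\ \gamma(b)=y\}.$$ (The infimum of the empty set, and a lower limit along an empty punctured neighbourhood, are $\infty$.) -/

import Mathlib

open Set Filter Topology MeasureTheory Bundle
open scoped Manifold ContDiff ENNReal

namespace SubFinsler

/-- A continuous fibre seminorm on the cotangent bundle `T*M`: a seminorm on each fibre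
`T*_x M` which is continuous as a function on the total space of the bundle. -/
structure FibreSeminorm (n : ℕ) (M : Type*) [TopologicalSpace M]
    [ChartedSpace (EuclideanSpace ℝ (Fin n)) M] [IsManifold (𝓡 n) ∞ M] where
  /-- the seminorm on the cotangent space at each point -/
  toFun : (x : M) → Seminorm ℝ (TangentSpace (𝓡 n) x →L[ℝ] ℝ)
  /-- continuity on the total space of `T*M`, with its vector bundle topology -/
  continuous_toFun : Continuous
    fun p : TotalSpace (EuclideanSpace ℝ (Fin n) →L[ℝ] ℝ)
      (fun x : M => TangentSpace (𝓡 n) x →L[ℝ] ℝ) => toFun p.1 p.2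

/-- The extended distance associated with a class of curves: the infimum of all `T > 0` such that
some curve of the class, defined on `[0, T]`, goes from `x` to `y` (and `∞` if there is none).
Here `Γ a b γ` says that the restriction of `γ` to `[a, b]` belongs to the class. -/
noncomputable def curveDist {M : Type*} (Γ : ℝ → ℝ → (ℝ → M) → Prop) (x y : M) : ℝ≥0∞ :=
  sInf {d | ∃ (T : ℝ) (γ : ℝ → M),
    0 < T ∧ Γ 0 T γ ∧ γ 0 = x ∧ γ T = y ∧ d = ENNReal.ofReal T}

/-- The topology induced by an extended distance function `ϱ`: a set is open when around each of
its points it contains some `ϱ`-ball of positive radius. -/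
@[reducible]
def distTopology {M : Type*} (ϱ : M → M → ℝ≥0∞) : TopologicalSpace M where
  IsOpen U := ∀ x ∈ U, ∃ ε : ℝ≥0∞, 0 < ε ∧ {y | ϱ x y < ε} ⊆ U
  isOpen_univ _ _ := ⟨1, one_pos, subset_univ _⟩
  isOpen_inter := by
    rintro U V hU hV x ⟨hxU, hxV⟩
    obtain ⟨ε, hε, h⟩ := hU x hxU
    obtain ⟨δ, hδ, h'⟩ := hV x hxV
    refine ⟨min ε δ, lt_min hε hδ, fun y hy => ?_⟩
    have hy' : ϱ x y < ε ∧ ϱ x y < δ := lt_min_iff.1 hy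
    exact ⟨h hy'.1, h' hy'.2⟩
  isOpen_sUnion := by
    rintro S hS x ⟨U, hU, hxU⟩
    obtain ⟨ε, hε, h⟩ := hS U hU x hxU
    exact ⟨ε, hε, h.trans (subset_sUnion_of_mem hU)⟩

/-- `ϱ` is varietal if the topology that it induces coincides with the manifold topology. -/
def IsVarietal {M : Type*} [τ : TopologicalSpace M] (ϱ : M → M → ℝ≥0∞) : Prop :=
  distTopology ϱ = τ

section

variable {n : ℕ} {M : Type*} [TopologicalSpace M] [ChartedSpace (EuclideanSpace ℝ (Fin n)) M]

/-- The curve `γ : [a, b] → M` is absolutely continuous: it is continuous and, in every smooth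
chart, it is absolutely continuous on each compact interval that it maps into the chart domain. -/
def IsACCurve (n : ℕ) {M : Type*} [TopologicalSpace M]
    [ChartedSpace (EuclideanSpace ℝ (Fin n)) M] (a b : ℝ) (γ : ℝ → M) : Prop :=
  ContinuousOn γ (Icc a b) ∧
    ∀ φ ∈ IsManifold.maximalAtlas (𝓡 n) ∞ M, ∀ c d : ℝ, a ≤ c → c ≤ d → d ≤ b →
      MapsTo γ (Icc c d) φ.source → AbsolutelyContinuousOnInterval (φ ∘ γ) c d

/-- The curve `γ : [a, b] → M` is smooth (up to the endpoints). -/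
def IsSmoothCurve (n : ℕ) {M : Type*} [TopologicalSpace M]
    [ChartedSpace (EuclideanSpace ℝ (Fin n)) M] (a b : ℝ) (γ : ℝ → M) : Prop :=
  ContMDiffOn 𝓘(ℝ, ℝ) (𝓡 n) ∞ γ (Icc a b)

/-- An atlas adapted to `M`: a countable locally finite family of smooth charts
`φ : U_φ → ℝⁿ`, each of them onto `ℝⁿ`, such that the sets `V_φ = φ⁻¹(B(0, 1))` cover `M`. -/
def IsAdaptedAtlas (A : Set (OpenPartialHomeomorph M (EuclideanSpace ℝ (Fin n)))) : Prop :=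
  A.Countable ∧ A ⊆ IsManifold.maximalAtlas (𝓡 n) ∞ M ∧ (∀ φ ∈ A, φ.target = univ) ∧
    LocallyFinite (fun φ : A => φ.1.source) ∧
    ⋃ φ ∈ A, φ.symm '' Metric.ball 0 1 = univ

/-- The expression in the chart `φ` (with image `ℝⁿ`) of a vector field. -/
noncomputable def chartField (φ : OpenPartialHomeomorph M (EuclideanSpace ℝ (Fin n)))
    (X : (x : M) → TangentSpace (𝓡 n) x) (p : EuclideanSpace ℝ (Fin n)) :
    EuclideanSpace ℝ (Fin n) :=
  mfderiv (𝓡 n) (𝓡 n) φ (φ.symm p) (X (φ.symm p))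

variable [IsManifold (𝓡 n) ∞ M]

/-- A smooth vector field on the subset `U` of `M` (its values outside `U` are irrelevant). -/
def IsSmoothFieldOn (U : Set M) (X : (x : M) → TangentSpace (𝓡 n) x) : Prop :=
  ContMDiffOn (𝓡 n) (𝓡 n).tangent ∞ (fun x => (⟨x, X x⟩ : TangentBundle (𝓡 n) M)) U

namespace FibreSeminorm

variable (P : FibreSeminorm n M)

/-- The dual extended fibre norm `P*` on `TM`: `P*_x(v) = sup {|ξ(v)| : ξ ∈ T*_x M, P(ξ) ≤ 1}`. -/
noncomputable def dual (x : M) (v : TangentSpace (𝓡 n) x) : ℝ≥0∞ :=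
  ⨆ (ξ : TangentSpace (𝓡 n) x →L[ℝ] ℝ) (_ : P.toFun x ξ ≤ 1), ENNReal.ofReal |ξ v|

/-- `P`-subunit curves on `[a, b]`: absolutely continuous, and with `P`-subunit velocity at almost
every time. -/
def IsSubunitCurve (a b : ℝ) (γ : ℝ → M) : Prop :=
  IsACCurve n a b γ ∧
    ∀ᵐ t ∂(volume.restrict (Icc a b)), ∃ v : TangentSpace (𝓡 n) (γ t),
      HasMFDerivAt 𝓘(ℝ, ℝ) (𝓡 n) γ t ((1 : ℝ →L[ℝ] ℝ).smulRight v) ∧ P.dual (γ t) v ≤ 1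

/-- Smooth `P`-subunit curves on `[a, b]`. -/
def IsSmoothSubunitCurve (a b : ℝ) (γ : ℝ → M) : Prop :=
  IsSmoothCurve n a b γ ∧ P.IsSubunitCurve a b γ

/-- `P`-subunit vector fields on the subset `U` of `M`: smooth on `U` and `P`-subunit at each
point of `U`. -/
def IsSubunitFieldOn (U : Set M) (X : (x : M) → TangentSpace (𝓡 n) x) : Prop :=
  IsSmoothFieldOn U X ∧ ∀ x ∈ U, P.dual x (X x) ≤ 1

/-- `P`-subunit piecewise flow curves on `[a, b]`: concatenations of finitely many flow curves of
(globally defined) `P`-subunit vector fields. -/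
def IsFlowCurve (a b : ℝ) (γ : ℝ → M) : Prop :=
  ∃ (k : ℕ) (t : ℕ → ℝ) (X : ℕ → (x : M) → TangentSpace (𝓡 n) x),
    Monotone t ∧ t 0 = a ∧ t k = b ∧
      ∀ i < k, P.IsSubunitFieldOn univ (X i) ∧
        IsMIntegralCurveOn γ (X i) (Icc (t i) (t (i + 1)))

/-- The extended distance `ϱ_P`. -/
noncomputable def rho : M → M → ℝ≥0∞ := curveDist P.IsSubunitCurve

/-- The extended distance `ϱ_P^∞`. -/
noncomputable def rhoSmooth : M → M → ℝ≥0∞ := curveDist P.IsSmoothSubunitCurve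

/-- The extended distance `ϱ_P^flow`. -/
noncomputable def rhoFlow : M → M → ℝ≥0∞ := curveDist P.IsFlowCurve

/-- The `P`-length of a curve on `[a, b]`: the supremum of
`∑ ϱ_P(γ(t_i), γ(t_{i+1}))` over all subdivisions `a = t_0 ≤ ⋯ ≤ t_m = b`. -/
noncomputable def length (a b : ℝ) (γ : ℝ → M) : ℝ≥0∞ :=
  ⨆ (m : ℕ) (t : ℕ → ℝ) (_ : Monotone t ∧ t 0 = a ∧ t m = b),
    ∑ i ∈ Finset.range m, P.rho (γ (t i)) (γ (t (i + 1)))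

/-- The Lipschitz seminorm condition: for each chart `φ` of an adapted atlas there are a countable
family of `P`-subunit vector fields on the chart domain and a constant `L` such that the fields are
`L`-Lipschitz on the unit ball in the coordinates `φ`, and at each point of `φ⁻¹(B(0, 1))` their
values are dense in the set of `P`-subunit vectors. (The condition does not depend on the choice of
the adapted atlas.) -/
def LipschitzCondition : Prop :=
  ∃ A : Set (OpenPartialHomeomorph M (EuclideanSpace ℝ (Fin n))), IsAdaptedAtlas A ∧
    ∀ φ ∈ A, ∃ (𝔛 : Set ((x : M) → TangentSpace (𝓡 n) x)) (L : ℝ),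
      𝔛.Countable ∧ (∀ X ∈ 𝔛, P.IsSubunitFieldOn φ.source X) ∧
      (∀ X ∈ 𝔛, ∀ p ∈ Metric.ball (0 : EuclideanSpace ℝ (Fin n)) 1,
        ∀ q ∈ Metric.ball (0 : EuclideanSpace ℝ (Fin n)) 1,
          ‖chartField φ X p - chartField φ X q‖ ≤ L * ‖p - q‖) ∧
      ∀ x ∈ φ.symm '' Metric.ball 0 1,
        closure ((fun X : (y : M) → TangentSpace (𝓡 n) y => X x) '' 𝔛) = {v | P.dual x v ≤ 1}

end FibreSeminorm

end

end SubFinsler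

/-!
The analytic content is a lower semicontinuity statement: the endpoint `y` of a `P`-subunit curve
`γ` on `[0, T]` starting at `x` is a limit of points reached from `x` by piecewise flow curves of
the same duration (`exists_flowReach_mem_of_isSubunitCurve`). After a subdivision of `[0, T]`, one
may work in a chart of the atlas given by the Lipschitz seminorm condition
(`exists_flowReach_of_chart`). Let `u` be the coordinate expression of `γ`, and let `D t` be the
distance, truncated by a small constant, from `u t` to the points that piecewise flow curves reach
at time `t`. Since a flow curve may stop, the increments of `D` are at most those of `u`. At almost
every `t` the velocity of `u` is approximated by `X (u t)` for some field `X` of the given family;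
following `X` for a short time from a nearly optimal point shows that the Dini derivative of `D` is
at most `L * D`. As `u` is absolutely continuous, the exceptional null set does not matter
(`le_of_ae_dini_nonpos`), and the Grönwall estimate `D t ≤ exp (L * (t - c)) * D c` follows
(`min_infDist_le_exp_mul`). No measurable choice of controls is needed. The fields of the family
are only defined in a chart; multiplication by a cutoff function makes them global.

A piecewise flow curve which reaches `y ≠ x` passes through points close to `y` and different from
`y` (`FlowReach.exists_ne_mem`), which gives the lower limit along the punctured neighbourhood.

For the distances, `ϱ_P ≤ ϱ_P^∞ ≤ ϱ_P^flow`; the second inequality and the triangle inequality for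
`ϱ_P^∞` hold because smooth subunit curves can be slowed down to rest at the cost of an
arbitrarily small delay and then concatenated smoothly (`IsSmoothSubunitCurve.exists_concat`). If
one of the last two distances is varietal, the triangle inequality through a point `z` near `y`
gives its equality with `ϱ_P` (`rho_eq_of_isVarietal`). The formula with lengths follows by affine
reparametrization of smooth subunit curves (`rho_eq_sInf_length`).
-/

namespace SubFinsler

/-! ### Absolutely continuous functions and a comparison principle -/

/-- A coordinate of an absolutely continuous curve has integrable derivative, so the increments of
the curve are dominated by those of the sum of the primitives of `|uᵢ'|`. -/
lemma exists_increment_bound {n : ℕ} {u : ℝ → EuclideanSpace ℝ (Fin n)} {c d : ℝ}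
    (hu : AbsolutelyContinuousOnInterval u c d) (hcd : c ≤ d) :
    ∃ G : ℝ → ℝ, AbsolutelyContinuousOnInterval G c d ∧
      ∀ s t, c ≤ s → s ≤ t → t ≤ d → ‖u t - u s‖ ≤ G t - G s := by
  have hcoord : ∀ i, AbsolutelyContinuousOnInterval (fun t => u t i) c d := by
    intro i
    rw [absolutelyContinuousOnInterval_iff] at hu ⊢
    intro ε hε
    obtain ⟨δ, hδ, h⟩ := hu ε hε
    refine ⟨δ, hδ, fun E hE hE' => (Finset.sum_le_sum fun j _ => ?_).trans_lt (h E hE hE')⟩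
    rw [dist_eq_norm, dist_eq_norm]
    exact PiLp.norm_apply_le (u (E.2 j).1 - u (E.2 j).2) i
  have hint : ∀ i, IntervalIntegrable (fun t => |deriv (fun t => u t i) t|) volume c d :=
    fun i => (hcoord i).intervalIntegrable_deriv.abs
  refine ⟨∑ i, fun t => ∫ v in c..t, |deriv (fun t => u t i) v|, ?_, ?_⟩
  · refine Finset.sum_induction _ (fun g : ℝ → ℝ => AbsolutelyContinuousOnInterval g c d)
      (fun _ _ h h' => h.add h') ?_ fun i _ =>
        (hint i).absolutelyContinuousOnInterval_intervalIntegral left_mem_uIcc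
    exact (LipschitzWith.const (0 : ℝ)).lipschitzOnWith.absolutelyContinuousOnInterval
  · intro s t hs hst ht
    have hsub : ∀ i, |(u t - u s) i| ≤ ∫ v in s..t, |deriv (fun t => u t i) v| := by
      intro i
      have hst' : uIcc s t ⊆ uIcc c d := by
        rw [uIcc_of_le hst, uIcc_of_le hcd]; exact Icc_subset_Icc hs ht
      rw [PiLp.sub_apply, ← ((hcoord i).mono hst').integral_deriv_eq_sub]
      exact intervalIntegral.abs_integral_le_integral_abs hst
    calc ‖u t - u s‖ ≤ ∑ i, |(u t - u s) i| := by
          rw [EuclideanSpace.norm_eq]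
          refine Real.sqrt_le_iff.2 ⟨Finset.sum_nonneg fun i _ => abs_nonneg _, ?_⟩
          simpa only [Real.norm_eq_abs] using
            Finset.sum_sq_le_sq_sum_of_nonneg fun i _ => abs_nonneg ((u t - u s) i)
      _ ≤ ∑ i, ∫ v in s..t, |deriv (fun t => u t i) v| := Finset.sum_le_sum fun i _ => hsub i
      _ = _ := by
          simp only [Finset.sum_apply, ← Finset.sum_sub_distrib]
          refine Finset.sum_congr rfl fun i _ => ?_
          rw [intervalIntegral.integral_interval_sub_left]
          · exact (hint i).mono_set (by
              rw [uIcc_of_le (hs.trans hst), uIcc_of_le hcd]; exact Icc_subset_Icc_right ht)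
          · exact (hint i).mono_set (by
              rw [uIcc_of_le hs, uIcc_of_le hcd]; exact Icc_subset_Icc_right (hst.trans ht))

/-- A function whose increments are dominated by those of an absolutely continuous function, and
whose lower right Dini derivative is almost everywhere nonpositive, does not increase. It may jump
downwards: `G - F` is monotone, and a monotone function increases by at least the integral of its
derivative. -/
lemma le_of_ae_dini_nonpos {F G : ℝ → ℝ} {c d : ℝ} (hcd : c ≤ d)
    (hG : AbsolutelyContinuousOnInterval G c d)
    (hFG : ∀ s t, c ≤ s → s ≤ t → t ≤ d → F t - F s ≤ G t - G s)
    (hF : ∀ᵐ t, t ∈ Ioo c d → ∀ η > 0, ∃ᶠ s in 𝓝[>] t, F s ≤ F t + η * (s - t)) :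
    F d ≤ F c := by
  set E : ℝ → ℝ := fun t => G t - F t with hE
  have hmono : MonotoneOn E (uIcc c d) := by
    rw [uIcc_of_le hcd]
    intro s hs t ht hst
    have := hFG s t hs.1 hst ht.2
    simp only [hE]; linarith
  have hEint := hmono.intervalIntegral_deriv_mem_uIcc
  have hEcd : 0 ≤ E d - E c := sub_nonneg.2 (hmono left_mem_uIcc right_mem_uIcc hcd)
  rw [uIcc_of_le hEcd] at hEint
  have hle : ∫ t in c..d, deriv G t ≤ ∫ t in c..d, deriv E t := by
    refine intervalIntegral.integral_mono_ae_restrict hcd hG.intervalIntegrable_deriv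
      hmono.intervalIntegrable_deriv ?_
    have hEd : ∀ᵐ t, t ∈ uIcc c d → DifferentiableWithinAt ℝ E (uIcc c d) t :=
      hmono.ae_differentiableWithinAt_of_mem
    have hends : ∀ᵐ t : ℝ, t ≠ c ∧ t ≠ d := by
      have h1 : ∀ᵐ t : ℝ, t ≠ c := by simp [ae_iff, measure_singleton]
      have h2 : ∀ᵐ t : ℝ, t ≠ d := by simp [ae_iff, measure_singleton]
      exact h1.and h2
    rw [EventuallyLE, ae_restrict_iff' measurableSet_Icc]
    filter_upwards [hEd, hG.ae_differentiableAt, hF, hends] with t htE htG htF htn ht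
    have hto : t ∈ Ioo c d := ⟨lt_of_le_of_ne ht.1 (Ne.symm htn.1), lt_of_le_of_ne ht.2 htn.2⟩
    rw [uIcc_of_le hcd] at htE htG
    have hE' : HasDerivAt E (deriv E t) t :=
      ((htE ht).differentiableAt (Icc_mem_nhds hto.1 hto.2)).hasDerivAt
    have hG' : HasDerivAt G (deriv G t) t := (htG ht).hasDerivAt
    have hF' : HasDerivAt F (deriv G t - deriv E t) t := by
      have := hG'.sub hE'
      refine this.congr_of_eventuallyEq (Eventually.of_forall fun s => ?_)
      simp [hE]
    -- the derivative of `F` is the limit of slopes, some of which are at most `η`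
    have hneg : deriv G t - deriv E t ≤ 0 := by
      refine le_of_forall_pos_le_add fun η hη => ?_
      have hlim := (hasDerivAt_iff_tendsto_slope.1 hF').mono_left
        (nhdsWithin_mono t (fun s (hs : t < s) => hs.ne'))
      refine le_of_tendsto_of_frequently hlim ?_
      refine ((htF hto η hη).and_eventually self_mem_nhdsWithin).mono ?_
      rintro s ⟨hs, hts⟩
      have hts' : 0 < s - t := sub_pos.2 hts
      rw [slope_def_field, div_le_iff₀ hts']
      linarith
    simpa using hneg
  rw [hG.integral_deriv_eq_sub] at hle
  have := hle.trans hEint.2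
  simp only [hE] at this
  linarith

/-! ### Integral curves in a ball -/

/-- Picard–Lindelöf on a closed ball, with the first-order error of the solution. The bound
is uniform in the initial point as long as the ball lies in a fixed region of control of `Y`. -/
lemma exists_integralCurve_in_closedBall {E : Type*} [NormedAddCommGroup E] [NormedSpace ℝ E]
    [CompleteSpace E] {Y : E → E} {p : E} {r C K h : ℝ} (hr : 0 ≤ r) (hC : 0 ≤ C) (hK : 0 ≤ K)
    (hh : 0 ≤ h) (hCh : C * h ≤ r) (hbd : ∀ q ∈ Metric.closedBall p r, ‖Y q‖ ≤ C)
    (hlip : ∀ q ∈ Metric.closedBall p r, ∀ q' ∈ Metric.closedBall p r,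
      ‖Y q - Y q'‖ ≤ K * ‖q - q'‖) :
    ∃ v : ℝ → E, v 0 = p ∧ (∀ t ∈ Icc 0 h, v t ∈ Metric.closedBall p r) ∧
      (∀ t ∈ Icc 0 h, HasDerivWithinAt v (Y (v t)) (Icc 0 h) t) ∧
      ‖v h - p - h • Y p‖ ≤ K * C * h ^ 2 := by
  lift r to NNReal using hr
  lift C to NNReal using hC
  lift K to NNReal using hK
  let t₀ : Icc (0 : ℝ) h := ⟨0, left_mem_Icc.2 hh⟩
  have hpl : IsPicardLindelof (fun _ => Y) t₀ p r 0 C K := by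
    refine IsPicardLindelof.of_time_independent hbd ?_ ?_
    · refine LipschitzOnWith.of_dist_le_mul fun q hq q' hq' => ?_
      rw [dist_eq_norm, dist_eq_norm]
      exact hlip q hq q' hq'
    · change C * max (h - 0) (0 - 0) ≤ r - 0
      simpa [hh] using hCh
  obtain ⟨α, hα⟩ := ODE.FunSpace.exists_isFixedPt_next hpl (Metric.mem_closedBall_self le_rfl)
  have h0 : α.compProj 0 = p := by
    have : α.compProj t₀ = p := by rw [ODE.FunSpace.compProj_val, ← hα, ODE.FunSpace.next_apply₀]
    exact this
  have hmem : ∀ t, α.compProj t ∈ Metric.closedBall p r :=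
    fun t => α.compProj_mem_closedBall hpl.mul_max_le
  have hder : ∀ t ∈ Icc 0 h,
      HasDerivWithinAt α.compProj (Y (α.compProj t)) (Icc 0 h) t := by
    intro t ht
    apply ODE.hasDerivWithinAt_picard_Icc (f := fun _ => Y) t₀.2 hpl.continuousOn_uncurry
      α.continuous_compProj.continuousOn (fun _ _ => hmem _) p ht |>.congr_of_mem _ ht
    intro t' ht'
    nth_rw 1 [← hα]
    rw [ODE.FunSpace.compProj_of_mem ht', ODE.FunSpace.next_apply]
  refine ⟨α.compProj, h0, fun t _ => hmem t, hder, ?_⟩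
  -- the solution stays within `C * h` of `p`, so its velocity stays within `K * C * h` of `Y p`
  have hgrow : ∀ t ∈ Icc 0 h, ‖α.compProj t - p‖ ≤ C * h := by
    intro t ht
    have := (convex_Icc 0 h).norm_image_sub_le_of_norm_hasDerivWithin_le hder
      (fun s _ => hbd _ (hmem s)) (left_mem_Icc.2 hh) ht
    rw [h0, sub_zero, Real.norm_eq_abs, abs_of_nonneg ht.1] at this
    exact this.trans (by gcongr; exact ht.2)
  have hder' : ∀ t ∈ Icc 0 h, HasDerivWithinAt (fun s => α.compProj s - s • Y p)
      (Y (α.compProj t) - Y p) (Icc 0 h) t := by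
    intro t ht
    have := (hder t ht).sub ((hasDerivWithinAt_id t (Icc 0 h)).smul_const (Y p))
    rwa [one_smul] at this
  have := (convex_Icc 0 h).norm_image_sub_le_of_norm_hasDerivWithin_le (C := K * (C * h)) hder'
    (fun t ht => (hlip _ (hmem t) p (Metric.mem_closedBall_self r.2)).trans
      (mul_le_mul_of_nonneg_left (hgrow t ht) K.2)) (left_mem_Icc.2 hh) (right_mem_Icc.2 hh)
  simp only [h0, zero_smul, sub_zero, Real.norm_eq_abs, abs_of_nonneg hh] at this
  calc _ = ‖α.compProj h - h • Y p - p‖ := by congr 1; abel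
    _ ≤ K * (C * h) * h := this
    _ = _ := by ring

/-! ### Distances defined by classes of curves -/

lemma curveDist_lt_iff {M : Type*} {Γ : ℝ → ℝ → (ℝ → M) → Prop} {x y : M} {b : ℝ≥0∞} :
    curveDist Γ x y < b ↔ ∃ (T : ℝ) (γ : ℝ → M),
      0 < T ∧ Γ 0 T γ ∧ γ 0 = x ∧ γ T = y ∧ ENNReal.ofReal T < b := by
  rw [curveDist, sInf_lt_iff]
  constructor
  · rintro ⟨_, ⟨T, γ, hT, hγ, hx, hy, rfl⟩, hb⟩
    exact ⟨T, γ, hT, hγ, hx, hy, hb⟩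
  · rintro ⟨T, γ, hT, hγ, hx, hy, hb⟩
    exact ⟨_, ⟨T, γ, hT, hγ, hx, hy, rfl⟩, hb⟩

lemma curveDist_le {M : Type*} {Γ : ℝ → ℝ → (ℝ → M) → Prop} {T : ℝ} {γ : ℝ → M}
    (hT : 0 < T) (hγ : Γ 0 T γ) : curveDist Γ (γ 0) (γ T) ≤ ENNReal.ofReal T :=
  sInf_le ⟨T, γ, hT, hγ, rfl, rfl, rfl⟩

lemma curveDist_mono {M : Type*} {Γ Γ' : ℝ → ℝ → (ℝ → M) → Prop}
    (h : ∀ a b γ, Γ a b γ → Γ' a b γ) (x y : M) : curveDist Γ' x y ≤ curveDist Γ x y := by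
  refine sInf_le_sInf ?_
  rintro _ ⟨T, γ, hT, hγ, hx, hy, rfl⟩
  exact ⟨T, γ, hT, h _ _ _ hγ, hx, hy, rfl⟩

lemma curveDist_self {M : Type*} {Γ : ℝ → ℝ → (ℝ → M) → Prop} {x : M}
    (h : ∀ T > 0, ∃ γ : ℝ → M, Γ 0 T γ ∧ γ 0 = x ∧ γ T = x) : curveDist Γ x x = 0 := by
  refine le_antisymm (ENNReal.le_of_forall_pos_le_add fun ε hε _ => ?_) bot_le
  obtain ⟨γ, hγ, h0, h1⟩ := h ε hε
  have := curveDist_le (Γ := Γ) (NNReal.coe_pos.2 hε) hγ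
  rwa [h0, h1, ENNReal.ofReal_coe_nnreal, ← zero_add (ε : ℝ≥0∞)] at this

/-- The triangle inequality for a class of curves which can be concatenated at the cost of an
arbitrarily small delay. -/
lemma curveDist_triangle {M : Type*} {Γ : ℝ → ℝ → (ℝ → M) → Prop}
    (h : ∀ (T S ε : ℝ) (γ σ : ℝ → M), 0 < T → 0 < S → 0 < ε → Γ 0 T γ → Γ 0 S σ → γ T = σ 0 →
      ∃ τ : ℝ → M, Γ 0 (T + S + ε) τ ∧ τ 0 = γ 0 ∧ τ (T + S + ε) = σ S) (x y z : M) :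
    curveDist Γ x z ≤ curveDist Γ x y + curveDist Γ y z := by
  refine ENNReal.le_of_forall_pos_le_add fun ε hε hfin => ?_
  obtain ⟨hxy, hyz⟩ := ENNReal.add_lt_top.1 hfin
  have hε3 : (0 : ℝ) < ε / 3 := by positivity
  have hε3' : ENNReal.ofReal (ε / 3) ≠ 0 := by simpa using hε3
  obtain ⟨T, γ, hT, hγ, rfl, rfl, hTb⟩ :=
    curveDist_lt_iff.1 (ENNReal.lt_add_right hxy.ne hε3')
  obtain ⟨S, σ, hS, hσ, hσ0, rfl, hSb⟩ :=
    curveDist_lt_iff.1 (ENNReal.lt_add_right hyz.ne hε3')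
  obtain ⟨τ, hτ, hτ0, hτ1⟩ := h T S (ε / 3) γ σ hT hS hε3 hγ hσ hσ0.symm
  have hle := curveDist_le (Γ := Γ) (by positivity) hτ
  rw [hτ0, hτ1] at hle
  have hsum : (ε : ℝ≥0∞) =
      ENNReal.ofReal (ε / 3) + ENNReal.ofReal (ε / 3) + ENNReal.ofReal (ε / 3) := by
    rw [← ENNReal.ofReal_add hε3.le hε3.le, ← ENNReal.ofReal_add (by positivity) hε3.le,
      ← ENNReal.ofReal_coe_nnreal]
    congr 1; ring
  calc _ ≤ ENNReal.ofReal (T + S + ε / 3) := hle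
    _ = ENNReal.ofReal T + ENNReal.ofReal S + ENNReal.ofReal (ε / 3) := by
        rw [ENNReal.ofReal_add (by positivity) hε3.le, ENNReal.ofReal_add hT.le hS.le]
    _ ≤ (curveDist Γ (γ 0) (γ T) + ENNReal.ofReal (ε / 3)) +
          (curveDist Γ (γ T) (σ S) + ENNReal.ofReal (ε / 3)) + ENNReal.ofReal (ε / 3) := by
        gcongr
    _ = _ := by rw [hsum]; ring

lemma curveDist_comm {M : Type*} {Γ : ℝ → ℝ → (ℝ → M) → Prop}
    (h : ∀ (T : ℝ) (γ : ℝ → M), 0 < T → Γ 0 T γ → ∃ τ : ℝ → M, Γ 0 T τ ∧ τ 0 = γ T ∧ τ T = γ 0)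
    (x y : M) : curveDist Γ x y = curveDist Γ y x := by
  have key : ∀ x y : M, curveDist Γ x y ≤ curveDist Γ y x := by
    intro x y
    refine le_of_forall_gt fun b hb => ?_
    obtain ⟨T, γ, hT, hγ, rfl, rfl, hTb⟩ := curveDist_lt_iff.1 hb
    obtain ⟨τ, hτ, h0, h1⟩ := h T γ hT hγ
    exact curveDist_lt_iff.2 ⟨T, τ, hT, hτ, h0, h1, hTb⟩
  exact le_antisymm (key x y) (key y x)

/-- Balls of a varietal distance which satisfies the triangle inequality are neighbourhoods of
their centres. -/
lemma IsVarietal.ball_mem_nhds {M : Type*} [τ : TopologicalSpace M] {ϱ : M → M → ℝ≥0∞}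
    (h : IsVarietal ϱ) (h0 : ∀ x, ϱ x x = 0) (htri : ∀ x y z, ϱ x z ≤ ϱ x y + ϱ y z)
    (x : M) {ε : ℝ≥0∞} (hε : 0 < ε) : {y | ϱ x y < ε} ∈ 𝓝 x := by
  have hopen : IsOpen[distTopology ϱ] {y | ϱ x y < ε} := by
    intro y hy
    refine ⟨ε - ϱ x y, tsub_pos_of_lt hy, fun z hz => ?_⟩
    exact (htri x y z).trans_lt (lt_tsub_iff_left.1 hz)
  have hopen' : IsOpen[τ] {y | ϱ x y < ε} := by
    have h' : distTopology ϱ = τ := h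
    rwa [h'] at hopen
  exact hopen'.mem_nhds (by simpa [h0 x] using hε)

/-! ### Subunit vectors and subunit fields -/

lemma isMIntegralCurveOn_reverse {n : ℕ} {M : Type*} [TopologicalSpace M]
    [ChartedSpace (EuclideanSpace ℝ (Fin n)) M] {X : (x : M) → TangentSpace (𝓡 n) x} {γ : ℝ → M} {h : ℝ}
    (hγ : IsMIntegralCurveOn γ X (Icc 0 h)) :
    IsMIntegralCurveOn (fun t => γ (h - t)) (-X) (Icc 0 h) := by
  have := (hγ.comp_add h).comp_mul (-1)
  have h2 : (γ ∘ (· + h)) ∘ (· * (-1)) = fun t => γ (h - t) := by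
    funext t; simp only [Function.comp_apply]; congr 1; ring
  rw [h2, neg_one_smul] at this
  refine this.mono fun t ht => ?_
  simp only [mem_ofPred_eq]
  constructor <;> linarith [ht.1, ht.2]

section

variable {n : ℕ} {M : Type*} [TopologicalSpace M] [ChartedSpace (EuclideanSpace ℝ (Fin n)) M]
  [IsManifold (𝓡 n) ∞ M]

namespace FibreSeminorm

variable {P : FibreSeminorm n M}

lemma dual_smul_le {x : M} {v : TangentSpace (𝓡 n) x} {c : ℝ} (hc : |c| ≤ 1)
    (hv : P.dual x v ≤ 1) : P.dual x (c • v) ≤ 1 := by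
  refine le_trans (iSup₂_mono fun ξ _ => ENNReal.ofReal_le_ofReal ?_) hv
  rw [map_smul, smul_eq_mul, abs_mul]
  exact mul_le_of_le_one_left (abs_nonneg _) hc

variable (P) in
lemma dual_zero_le (x : M) : P.dual x 0 ≤ 1 :=
  iSup₂_le fun ξ _ => by simp

variable (P) in
lemma isSubunitFieldOn_zero : P.IsSubunitFieldOn univ (fun _ => 0) :=
  ⟨(Bundle.contMDiff_zeroSection ℝ (TangentSpace (𝓡 n) : M → Type _)).contMDiffOn,
    fun x _ => P.dual_zero_le x⟩

lemma IsSubunitFieldOn.neg {X : (x : M) → TangentSpace (𝓡 n) x}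
    (hX : P.IsSubunitFieldOn univ X) : P.IsSubunitFieldOn univ (-X) := by
  refine ⟨(contMDiffOn_univ.1 hX.1).neg_section.contMDiffOn, fun x hx => ?_⟩
  have := dual_smul_le (c := -1) (by simp) (hX.2 x hx)
  rwa [neg_one_smul] at this

/-! ### Points reached by piecewise flow curves -/

/-- `P.FlowReach x y T`: a finite chain of integral curves of globally defined `P`-subunit fields,
of total duration `T`, goes from `x` to `y`. Each integral curve is parametrized from time `0`, so
that chains can be concatenated without a change of parameter. -/
inductive FlowReach (P : FibreSeminorm n M) (x : M) : M → ℝ → Prop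
  | refl : FlowReach P x x 0
  | step {T h : ℝ} {X : (x : M) → TangentSpace (𝓡 n) x} {γ : ℝ → M} :
    FlowReach P x (γ 0) T → 0 ≤ h → P.IsSubunitFieldOn univ X →
      IsMIntegralCurveOn γ X (Icc 0 h) → FlowReach P x (γ h) (T + h)

lemma FlowReach.nonneg {x y : M} {T : ℝ} (h : P.FlowReach x y T) : 0 ≤ T := by
  induction h with
  | refl => exact le_rfl
  | step _ hh _ _ ih => exact add_nonneg ih hh

lemma FlowReach.single {X : (x : M) → TangentSpace (𝓡 n) x} {γ : ℝ → M} {h : ℝ} (hh : 0 ≤ h)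
    (hX : P.IsSubunitFieldOn univ X) (hγ : IsMIntegralCurveOn γ X (Icc 0 h)) :
    P.FlowReach (γ 0) (γ h) h := by
  simpa using FlowReach.step FlowReach.refl hh hX hγ

lemma FlowReach.trans {x y z : M} {T S : ℝ} (h : P.FlowReach x y T) (h' : P.FlowReach y z S) :
    P.FlowReach x z (T + S) := by
  induction h' with
  | refl => simpa using h
  | step _ hh hX hγ ih => rw [← add_assoc]; exact ih.step hh hX hγ

/-- Time can be spent at a point by following the zero field. -/
lemma FlowReach.mono {x y : M} {T S : ℝ} (h : P.FlowReach x y T) (hTS : T ≤ S) :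
    P.FlowReach x y S := by
  have := FlowReach.step (γ := fun _ => y) h (sub_nonneg.2 hTS) P.isSubunitFieldOn_zero
    (fun t _ => by
      have := hasMFDerivWithinAt_const (I := 𝓘(ℝ, ℝ)) (I' := 𝓡 n) (c := y) (s := Icc 0 (S - T))
        (x := t)
      rwa [show (0 : TangentSpace 𝓘(ℝ, ℝ) t →L[ℝ] TangentSpace (𝓡 n) y) =
        (1 : ℝ →L[ℝ] ℝ).smulRight (0 : TangentSpace (𝓡 n) y) from
          (ContinuousLinearMap.smulRight_zero _).symm] at this)
  simpa using this

lemma FlowReach.symm {x y : M} {T : ℝ} (h : P.FlowReach x y T) : P.FlowReach y x T := by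
  induction h with
  | refl => exact FlowReach.refl
  | @step T h X γ _ hh hX hγ ih =>
    have := FlowReach.single hh hX.neg (isMIntegralCurveOn_reverse hγ)
    simp only [sub_zero, sub_self] at this
    rw [add_comm]
    exact this.trans ih

lemma IsFlowCurve.flowReach {γ : ℝ → M} {a b : ℝ} (h : P.IsFlowCurve a b γ) :
    P.FlowReach (γ a) (γ b) (b - a) := by
  obtain ⟨k, t, X, ht, rfl, rfl, h⟩ := h
  have key : ∀ i ≤ k, P.FlowReach (γ (t 0)) (γ (t i)) (t i - t 0) := by
    intro i
    induction i with
    | zero => intro _; rw [sub_self]; exact FlowReach.refl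
    | succ i ih =>
      intro hi
      obtain ⟨hX, hγ⟩ := h i hi
      have hle : t i ≤ t (i + 1) := ht i.le_succ
      have hγ' : IsMIntegralCurveOn (γ ∘ (· + t i)) (X i) (Icc 0 (t (i + 1) - t i)) := by
        refine (hγ.comp_add (t i)).mono fun s hs => ?_
        exact ⟨by linarith [hs.1], by linarith [hs.2]⟩
      have := FlowReach.single (sub_nonneg.2 hle) hX hγ'
      simp only [Function.comp_apply, zero_add, sub_add_cancel] at this
      have := (ih (Nat.le_of_succ_le hi)).trans this
      rwa [show t i - t 0 + (t (i + 1) - t i) = t (i + 1) - t 0 by ring] at this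
  exact key k le_rfl

lemma FlowReach.exists_isFlowCurve {x y : M} {T : ℝ} (h : P.FlowReach x y T) :
    ∃ γ : ℝ → M, P.IsFlowCurve 0 T γ ∧ γ 0 = x ∧ γ T = y := by
  induction h with
  | refl => exact ⟨fun _ => x, ⟨0, fun _ => 0, fun _ _ => 0, monotone_const, rfl, rfl, by simp⟩,
      rfl, rfl⟩
  | @step T h X σ hr hh hX hσ ih =>
    obtain ⟨γ, ⟨k, t, Y, ht, h0, hk, hγ⟩, hγ0, hγT⟩ := ih
    have hT := hr.nonneg
    let γ' : ℝ → M := fun s => if s ≤ T then γ s else σ (s - T)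
    have hγ'1 : ∀ s ≤ T, γ' s = γ s := fun s hs => if_pos hs
    have hγ'2 : ∀ s, T ≤ s → γ' s = σ (s - T) := by
      intro s hs
      rcases hs.eq_or_lt with rfl | hs
      · rw [hγ'1 _ le_rfl, hγT, sub_self]
      · exact if_neg hs.not_ge
    refine ⟨γ', ⟨k + 1, fun i => if i ≤ k then t i else T + h, fun i => if i < k then Y i else X,
      ?_, by simpa using h0, by simp, ?_⟩, ?_, ?_⟩
    · refine monotone_nat_of_le_succ fun i => ?_
      rcases lt_trichotomy i k with hik | rfl | hik
      · simp only [hik.le, Nat.succ_le_of_lt hik, if_true]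
        exact ht i.le_succ
      · simp [hk, hh]
      · simp [hik.not_ge, (hik.trans i.lt_succ_self).not_ge]
    · intro i hi
      rcases (Nat.lt_succ_iff.1 hi).eq_or_lt with rfl | hik
      · simp only [lt_irrefl, if_false, le_refl, if_true, hk, Nat.not_succ_le_self]
        refine ⟨hX, ?_⟩
        have hσ' : IsMIntegralCurveOn (σ ∘ (· + (-T))) X (Icc T (T + h)) := by
          refine (hσ.comp_add (-T)).mono fun s hs => ?_
          exact ⟨by linarith [hs.1], by linarith [hs.2]⟩
        intro s hs
        have h2 := hγ'2 s hs.1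
        have := (hσ' s hs).congr_of_eventuallyEq (f₁ := γ')
          (eventually_nhdsWithin_of_forall fun r hr => hγ'2 r hr.1) h2
        rw [h2]
        exact this
      · simp only [hik, if_true, hik.le, Nat.succ_le_of_lt hik]
        refine ⟨(hγ i hik).1, fun s hs => ?_⟩
        have hle : ∀ r ∈ Icc (t i) (t (i + 1)), r ≤ T := fun r hr =>
          hr.2.trans (hk ▸ ht (Nat.succ_le_of_lt hik))
        have h2 := hγ'1 s (hle s hs)
        have := ((hγ i hik).2 s hs).congr_of_eventuallyEq (f₁ := γ')
          (eventually_nhdsWithin_of_forall fun r hr => hγ'1 r (hle r hr)) h2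
        rw [h2]
        exact this
    · rw [hγ'1 0 hT, hγ0]
    · rw [hγ'2 _ (by linarith)]; congr 1; ring

lemma FlowReach.rhoFlow_le {x y : M} {T : ℝ} (h : P.FlowReach x y T) (hT : 0 < T) :
    P.rhoFlow x y ≤ ENNReal.ofReal T := by
  obtain ⟨γ, hγ, rfl, rfl⟩ := h.exists_isFlowCurve
  exact curveDist_le hT hγ

variable (P)

lemma rhoFlow_self (x : M) : P.rhoFlow x x = 0 :=
  curveDist_self fun _ hT => (FlowReach.refl.mono hT.le).exists_isFlowCurve

lemma rhoFlow_triangle (x y z : M) : P.rhoFlow x z ≤ P.rhoFlow x y + P.rhoFlow y z := by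
  refine curveDist_triangle (fun T S ε γ σ _ _ hε hγ hσ hγσ => ?_) x y z
  have h1 := hγ.flowReach
  have h2 := hσ.flowReach
  rw [hγσ, sub_zero] at h1
  rw [sub_zero] at h2
  exact ((h1.trans h2).mono (le_add_of_nonneg_right hε.le)).exists_isFlowCurve

lemma rhoFlow_comm (x y : M) : P.rhoFlow x y = P.rhoFlow y x := by
  refine curveDist_comm (fun T γ _ hγ => ?_) x y
  have h1 := hγ.flowReach.symm
  rw [sub_zero] at h1
  exact h1.exists_isFlowCurve

/-- If a piecewise flow curve reaches `y ≠ x`, its last nonconstant part passes through points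
near `y` and different from `y`. -/
lemma FlowReach.exists_ne_mem [T1Space M] {P : FibreSeminorm n M} {x y : M} {T : ℝ}
    (h : P.FlowReach x y T) (hxy : x ≠ y) {W : Set M} (hW : W ∈ 𝓝 y) :
    ∃ z ∈ W, z ≠ y ∧ P.FlowReach x z T := by
  induction h with
  | refl => exact absurd rfl hxy
  | @step T h X γ hr hh hX hγ ih =>
    by_cases hne : γ 0 = γ h
    · obtain ⟨z, hz, hzne, hzr⟩ := ih (hne ▸ hxy) (hne ▸ hW)
      exact ⟨z, hz, hne ▸ hzne, hzr.mono (le_add_of_nonneg_right hh)⟩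
    -- the image of the last piece is connected and is not contained in `{y}`, so `y` is not isolated
    -- in it
    · obtain ⟨U, hUW, hU, hyU⟩ := mem_nhds_iff.1 hW
      have hconn : IsPreconnected (γ '' Icc 0 h) :=
        isPreconnected_Icc.image γ fun t ht => (hγ t ht).continuousWithinAt
      obtain ⟨_, ⟨s, hs, rfl⟩, hsU, hsne⟩ := hconn U {γ h}ᶜ hU isOpen_compl_singleton
        (fun z _ => (em (z = γ h)).imp (fun hz : z = γ h => hz ▸ hyU) id)
        ⟨γ h, mem_image_of_mem γ (right_mem_Icc.2 hh), hyU⟩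
        ⟨γ 0, mem_image_of_mem γ (left_mem_Icc.2 hh), hne⟩
      refine ⟨γ s, hUW hsU, hsne, (hr.step hs.1 hX (hγ.mono (Icc_subset_Icc_right hs.2))).mono ?_⟩
      linarith [hs.2]

end FibreSeminorm

end

section

variable {n : ℕ} {M : Type*} [TopologicalSpace M] [ChartedSpace (EuclideanSpace ℝ (Fin n)) M]
  {φ : OpenPartialHomeomorph M (EuclideanSpace ℝ (Fin n))}

/-! ### Curves and vector fields in charts -/

lemma mdifferentiable_of_mem_maximalAtlas (hφ : φ ∈ IsManifold.maximalAtlas (𝓡 n) ∞ M) :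
    φ.MDifferentiable (𝓡 n) (𝓡 n) :=
  ⟨(contMDiffOn_of_mem_maximalAtlas hφ).mdifferentiableOn (by simp),
    (contMDiffOn_symm_of_mem_maximalAtlas hφ).mdifferentiableOn (by simp)⟩

lemma hasDerivWithinAt_chart_comp (hφ : φ ∈ IsManifold.maximalAtlas (𝓡 n) ∞ M) {γ : ℝ → M}
    {s : Set ℝ} {t : ℝ} (ht : γ t ∈ φ.source) {w : TangentSpace (𝓡 n) (γ t)}
    (hγ : HasMFDerivWithinAt 𝓘(ℝ, ℝ) (𝓡 n) γ s t ((1 : ℝ →L[ℝ] ℝ).smulRight w))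
    {w' : EuclideanSpace ℝ (Fin n)} (hw : w' = mfderiv (𝓡 n) (𝓡 n) φ (γ t) w) :
    HasDerivWithinAt (φ ∘ γ) w' s t := by
  have h1 := ((mdifferentiable_of_mem_maximalAtlas hφ).mdifferentiableAt ht).hasMFDerivAt
  have h2 : HasFDerivWithinAt (φ ∘ γ) ((1 : ℝ →L[ℝ] ℝ).smulRight w') s t := by
    have h3 := (h1.comp_hasMFDerivWithinAt t hγ).hasFDerivWithinAt
    have h4 : ((1 : ℝ →L[ℝ] ℝ).smulRight w') =
        (mfderiv (𝓡 n) (𝓡 n) φ (γ t)).comp ((1 : ℝ →L[ℝ] ℝ).smulRight w) := by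
      refine ContinuousLinearMap.ext fun r => ?_
      change r • w' = mfderiv (𝓡 n) (𝓡 n) φ (γ t) (r • w)
      rw [map_smul]
      exact congrArg (r • ·) hw
    rw [h4]
    exact h3
  simpa using h2.hasDerivWithinAt

lemma hasDerivAt_chart_comp (hφ : φ ∈ IsManifold.maximalAtlas (𝓡 n) ∞ M) {γ : ℝ → M}
    {t : ℝ} (ht : γ t ∈ φ.source) {w : TangentSpace (𝓡 n) (γ t)}
    (hγ : HasMFDerivAt 𝓘(ℝ, ℝ) (𝓡 n) γ t ((1 : ℝ →L[ℝ] ℝ).smulRight w))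
    {w' : EuclideanSpace ℝ (Fin n)} (hw : w' = mfderiv (𝓡 n) (𝓡 n) φ (γ t) w) :
    HasDerivAt (φ ∘ γ) w' t := by
  rw [← hasDerivWithinAt_univ]
  exact hasDerivWithinAt_chart_comp hφ ht hγ.hasMFDerivWithinAt hw

/-- A solution in coordinates of the equation given by `chartField φ X` is an integral curve of
`X`. -/
lemma hasMFDerivWithinAt_chart_symm_comp (hφ : φ ∈ IsManifold.maximalAtlas (𝓡 n) ∞ M)
    {X : (x : M) → TangentSpace (𝓡 n) x} {v : ℝ → EuclideanSpace ℝ (Fin n)}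
    {s : Set ℝ} {t : ℝ} (ht : v t ∈ φ.target)
    (hv : HasDerivWithinAt v (chartField φ X (v t)) s t) :
    HasMFDerivWithinAt 𝓘(ℝ, ℝ) (𝓡 n) (φ.symm ∘ v) s t
      ((1 : ℝ →L[ℝ] ℝ).smulRight (X (φ.symm (v t)))) := by
  have hd := mdifferentiable_of_mem_maximalAtlas hφ
  have h1 := (hd.mdifferentiableAt_symm ht).hasMFDerivAt
  have h2 : HasMFDerivWithinAt 𝓘(ℝ, ℝ) (𝓡 n) v s t
      ((1 : ℝ →L[ℝ] ℝ).smulRight (chartField φ X (v t))) :=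
    hv.hasFDerivWithinAt.hasMFDerivWithinAt
  have h3 := h1.comp_hasMFDerivWithinAt t h2
  have hinv := hd.symm_comp_deriv (φ.map_target ht)
  rw [φ.right_inv ht] at hinv
  have h4 : ((1 : ℝ →L[ℝ] ℝ).smulRight (X (φ.symm (v t)))) =
      (mfderiv (𝓡 n) (𝓡 n) φ.symm (v t)).comp
        ((1 : ℝ →L[ℝ] ℝ).smulRight (chartField φ X (v t))) := by
    refine ContinuousLinearMap.ext fun r => ?_
    have := DFunLike.congr_fun hinv (X (φ.symm (v t)))
    exact (congrArg (fun w : TangentSpace (𝓡 n) (φ.symm (v t)) => r • w) this.symm).trans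
      ((mfderiv (𝓡 n) (𝓡 n) φ.symm (v t)).map_smul r (chartField φ X (v t))).symm
  rw [h4]
  exact h3

variable [IsManifold (𝓡 n) ∞ M]

lemma contDiffOn_chartField (hφ : φ ∈ IsManifold.maximalAtlas (𝓡 n) ∞ M)
    {X : (x : M) → TangentSpace (𝓡 n) x} (hX : IsSmoothFieldOn univ X) :
    ContDiffOn ℝ ∞ (chartField φ X) φ.target := by
  have h1 : ContMDiffOn (𝓡 n).tangent (𝓡 n).tangent ∞ (tangentMapWithin (𝓡 n) (𝓡 n) φ φ.source)
      (TotalSpace.proj ⁻¹' φ.source) :=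
    (contMDiffOn_of_mem_maximalAtlas hφ).contMDiffOn_tangentMapWithin (by simp)
      φ.open_source.uniqueMDiffOn
  have h2 : ContMDiffOn (𝓡 n) (𝓡 n).tangent ∞
      (fun p => (⟨φ.symm p, X (φ.symm p)⟩ : TangentBundle (𝓡 n) M)) φ.target :=
    hX.comp (contMDiffOn_symm_of_mem_maximalAtlas hφ) fun _ _ => mem_univ _
  have h3 := h1.comp h2 fun p hp => φ.map_target hp
  refine contMDiffOn_vectorSpace_iff_contDiffOn.1 (h3.congr fun p hp => ?_)
  simp only [Function.comp_apply, tangentMapWithin, chartField]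
  rw [mfderivWithin_of_isOpen φ.open_source (φ.map_target hp)]
  congr 1
  exact (φ.right_inv hp).symm

/-- Integral curves of smooth vector fields are smooth up to the endpoints. -/
lemma isSmoothCurve_of_isMIntegralCurveOn {X : (x : M) → TangentSpace (𝓡 n) x}
    (hX : IsSmoothFieldOn univ X) {γ : ℝ → M} {a b : ℝ}
    (hγ : IsMIntegralCurveOn γ X (Icc a b)) : IsSmoothCurve n a b γ := by
  intro t ht
  set ψ := chartAt (EuclideanSpace ℝ (Fin n)) (γ t) with hψ
  have hψA : ψ ∈ IsManifold.maximalAtlas (𝓡 n) ∞ M := IsManifold.chart_mem_maximalAtlas _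
  have hcont : ContinuousOn γ (Icc a b) := fun s hs => (hγ s hs).continuousWithinAt
  have hsrc : γ ⁻¹' ψ.source ∈ 𝓝[Icc a b] t :=
    (hcont t ht).preimage_mem_nhdsWithin (ψ.open_source.mem_nhds (mem_chart_source _ _))
  obtain ⟨δ, hδ, hball⟩ := Metric.mem_nhdsWithin_iff.1 hsrc
  -- a neighbourhood of `t` in `[a, b]` which `γ` maps into the chart domain
  set a' := max a (t - δ / 2)
  set b' := min b (t + δ / 2)
  have hsub : Icc a' b' ⊆ Icc a b := Icc_subset_Icc (le_max_left _ _) (min_le_left _ _)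
  have hmap : MapsTo γ (Icc a' b') ψ.source := by
    intro s hs
    refine hball ⟨?_, hsub hs⟩
    rw [Metric.mem_ball, Real.dist_eq, abs_lt]
    have h1 := (le_max_right a (t - δ / 2)).trans hs.1
    have h2 := hs.2.trans (min_le_right b (t + δ / 2))
    constructor <;> linarith
  have hnhds : Icc a' b' ∈ 𝓝[Icc a b] t := by
    refine Metric.mem_nhdsWithin_iff.2 ⟨δ / 2, half_pos hδ, ?_⟩
    rintro s ⟨hs, hs'⟩
    rw [Metric.mem_ball, Real.dist_eq, abs_lt] at hs
    exact ⟨max_le hs'.1 (by linarith [hs.1]), le_min hs'.2 (by linarith [hs.2])⟩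
  have hder : ∀ s ∈ Icc a' b', HasDerivWithinAt (ψ ∘ γ)
      ((fun _ => chartField ψ X) s ((ψ ∘ γ) s)) (Icc a' b') s := by
    intro s hs
    refine hasDerivWithinAt_chart_comp hψA (hmap hs) ((hγ s (hsub hs)).mono hsub) ?_
    simp only [chartField, Function.comp_apply]
    rw [ψ.left_inv (hmap hs)]
    rfl
  -- in the chart, solutions of a smooth equation are smooth
  have hu : ContDiffOn ℝ ∞ (ψ ∘ γ) (Icc a' b') := by
    refine ODE.contDiffOn_enat_Icc_of_hasDerivWithinAt (n := ⊤) (u := ψ.target) ?_ hder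
      fun s hs => ψ.map_source (hmap hs)
    exact (contDiffOn_chartField hψA hX).comp contDiffOn_snd fun p hp => hp.2
  have hγ' : ContMDiffOn 𝓘(ℝ, ℝ) (𝓡 n) ∞ γ (Icc a' b') := by
    refine ((contMDiffOn_symm_of_mem_maximalAtlas hψA).comp hu.contMDiffOn
      fun s hs => ψ.map_source (hmap hs)).congr fun s hs => ?_
    exact (ψ.left_inv (hmap hs)).symm
  have htm : t ∈ Icc a' b' := mem_of_mem_nhdsWithin ht hnhds
  exact (hγ' t htm).mono_of_mem_nhdsWithin hnhds

/-- A field which is subunit on the domain of a chart onto `ℝⁿ` agrees, over the unit ball, with a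
globally defined subunit field, obtained by multiplication with a cutoff function. -/
lemma FibreSeminorm.IsSubunitFieldOn.exists_global [T2Space M] [SigmaCompactSpace M]
    {P : FibreSeminorm n M} (htarget : φ.target = univ) {X : (x : M) → TangentSpace (𝓡 n) x}
    (hX : P.IsSubunitFieldOn φ.source X) :
    ∃ X' : (x : M) → TangentSpace (𝓡 n) x, P.IsSubunitFieldOn univ X' ∧
      ∀ x ∈ φ.symm '' Metric.ball 0 1, X' x = X x := by
  have hcont : ContinuousOn φ.symm univ := htarget ▸ φ.continuousOn_symm
  have hcpt : ∀ r : ℝ, IsClosed (φ.symm '' Metric.closedBall 0 r) := fun r =>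
    ((isCompact_closedBall 0 r).image_of_continuousOn (hcont.mono (subset_univ _))).isClosed
  have hopen : IsOpen (φ.symm '' Metric.ball 0 2) :=
    φ.symm.isOpen_image_of_subset_source Metric.isOpen_ball (by simp [htarget])
  obtain ⟨χ, hχ0, hχ1, hχ⟩ := exists_contMDiffMap_zero_one_of_isClosed (n := ⊤) (𝓡 n)
    hopen.isClosed_compl (hcpt 1) (by
      rw [disjoint_compl_left_iff_subset]
      exact image_mono (Metric.closedBall_subset_ball (by norm_num)))
  have hsupp : tsupport χ ⊆ φ.source := by
    have h1 : Function.support χ ⊆ φ.symm '' Metric.closedBall 0 2 := by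
      intro x hx
      by_contra hx'
      exact hx (hχ0 fun h => hx' (image_mono Metric.ball_subset_closedBall h))
    refine (closure_minimal h1 (hcpt 2)).trans ?_
    rintro _ ⟨p, -, rfl⟩
    exact φ.map_target (htarget ▸ mem_univ p)
  refine ⟨(χ : M → ℝ) • X, ⟨?_, fun x _ => ?_⟩, fun x hx => ?_⟩
  · exact (ContMDiffOn.smul_section_of_tsupport χ.contMDiff.contMDiffOn φ.open_source hsupp
      hX.1).contMDiffOn
  · by_cases hx : x ∈ φ.source
    · refine dual_smul_le ?_ (hX.2 x hx)
      rw [abs_of_nonneg (hχ x).1]; exact (hχ x).2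
    · have h0 : χ x = 0 := image_eq_zero_of_notMem_tsupport fun h => hx (hsupp h)
      simp only [Pi.smul_apply', h0, zero_smul]
      exact P.dual_zero_le x
  · have h1 : χ x = 1 := hχ1 (image_mono Metric.ball_subset_closedBall hx)
    simp only [Pi.smul_apply', h1, one_smul]

end

/-! ### Approximation of subunit curves by piecewise flow curves -/

/-- Suppose that sets `R t ⊆ ℝⁿ` grow with `t`, and that from a point of `R t` near `u t` one can
move in `R` along each of the fields `Y j`, to first order. If the velocity of `u` is almost
everywhere a limit of values of the fields, then the truncated distance from `u t` to `R t`
satisfies a Grönwall estimate, since its Dini derivative is at most `L` times itself. -/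
lemma min_infDist_le_exp_mul {n : ℕ} {u : ℝ → EuclideanSpace ℝ (Fin n)} {c d : ℝ} (hcd : c ≤ d)
    (hu : AbsolutelyContinuousOnInterval u c d) {R : ℝ → Set (EuclideanSpace ℝ (Fin n))}
    (hne : (R c).Nonempty) (hmono : ∀ s t, c ≤ s → s ≤ t → R s ⊆ R t) {r L : ℝ} (hr : 0 < r)
    (hL : 0 ≤ L) {ι : Type*} {Y : ι → EuclideanSpace ℝ (Fin n) → EuclideanSpace ℝ (Fin n)}
    (hstep : ∀ j, ∃ h₀ > 0, ∃ C : ℝ, ∀ t ∈ Icc c d, ∀ p ∈ R t, ‖p - u t‖ ≤ r → ∀ h ∈ Icc 0 h₀,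
      ∃ q ∈ R (t + h), ‖q - p - h • Y j p‖ ≤ C * h ^ 2)
    (hlip : ∀ j, ∀ t ∈ Icc c d, ∀ p, ‖p - u t‖ ≤ r → ‖Y j p - Y j (u t)‖ ≤ L * ‖p - u t‖)
    (hder : ∀ᵐ t, t ∈ Ioo c d → ∃ w, HasDerivAt u w t ∧ w ∈ closure (range fun j => Y j (u t))) :
    min r (Metric.infDist (u d) (R d)) ≤ Real.exp (L * (d - c)) * Metric.infDist (u c) (R c) := by
  set δ : ℝ → ℝ := fun t => Metric.infDist (u t) (R t) with hδ
  set D : ℝ → ℝ := fun t => min r (δ t) with hD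
  have hδ0 : ∀ t, 0 ≤ δ t := fun t => Metric.infDist_nonneg
  have hD0 : ∀ t, 0 ≤ D t := fun t => le_min hr.le (hδ0 t)
  have hneR : ∀ t, c ≤ t → (R t).Nonempty := fun t ht => hne.mono (hmono c t le_rfl ht)
  have hDinc : ∀ s t, c ≤ s → s ≤ t → D t ≤ D s + ‖u t - u s‖ := by
    intro s t hs hst
    have h1 : δ t ≤ δ s + ‖u t - u s‖ := by
      rw [← dist_eq_norm]
      exact (Metric.infDist_le_infDist_of_subset (hmono s t hs hst) (hneR s hs)).trans
        Metric.infDist_le_infDist_add_dist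
    simp only [hD]
    rw [← min_add_add_right]
    exact min_le_min (le_add_of_nonneg_right (norm_nonneg _)) h1
  -- the exponential factor absorbs the term `L * D t` of the Dini derivative of `D`
  set F : ℝ → ℝ := fun t => Real.exp (-(L * (t - c))) * D t with hF
  have hexp : ∀ t, c ≤ t → Real.exp (-(L * (t - c))) ≤ 1 := fun t ht =>
    Real.exp_le_one_iff.2 (neg_nonpos.2 (mul_nonneg hL (sub_nonneg.2 ht)))
  have hexpmono : ∀ s t, s ≤ t → Real.exp (-(L * (t - c))) ≤ Real.exp (-(L * (s - c))) :=
    fun s t hst => Real.exp_le_exp.2 (neg_le_neg (mul_le_mul_of_nonneg_left (by linarith) hL))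
  obtain ⟨G, hG, hGu⟩ := exists_increment_bound hu hcd
  have hFG : ∀ s t, c ≤ s → s ≤ t → t ≤ d → F t - F s ≤ G t - G s := by
    intro s t hs hst ht
    refine le_trans ?_ (hGu s t hs hst ht)
    have h1 : F t ≤ Real.exp (-(L * (t - c))) * (D s + ‖u t - u s‖) :=
      mul_le_mul_of_nonneg_left (hDinc s t hs hst) (Real.exp_pos _).le
    have h2 : Real.exp (-(L * (t - c))) * D s ≤ F s :=
      mul_le_mul_of_nonneg_right (hexpmono s t hst) (hD0 s)
    have h3 : Real.exp (-(L * (t - c))) * ‖u t - u s‖ ≤ ‖u t - u s‖ :=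
      mul_le_of_le_one_left (norm_nonneg _) (hexp t (hs.trans hst))
    linarith
  have hdini : ∀ᵐ t, t ∈ Ioo c d → ∀ η > 0, ∃ᶠ s in 𝓝[>] t, F s ≤ F t + η * (s - t) := by
    filter_upwards [hder] with t ht htcd η hη
    refine Eventually.frequently ?_
    rcases le_or_gt r (δ t) with hrδ | hrδ
    -- where `D t` attains its maximal value `r`, it cannot increase
    · filter_upwards [self_mem_nhdsWithin] with s (hs : t < s)
      have h1 : F s ≤ Real.exp (-(L * (t - c))) * r :=
        mul_le_mul (hexpmono t s hs.le) (min_le_left _ _) (hD0 s) (Real.exp_pos _).le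
      have h2 : F t = Real.exp (-(L * (t - c))) * r := by
        simp only [hF, hD, min_eq_left hrδ]
      have := mul_pos hη (sub_pos.2 hs)
      linarith
    -- otherwise some `p ∈ R t` is nearly closest to `u t`, and moving from `p` along a field `Y j`
    -- with `Y j (u t)` close to the velocity of `u` follows `u` up to a small error; this error has
    -- five parts, bounded by `(4 + L) * η' * h` apart from the term `δ t * (1 + L * h)`
    · obtain ⟨w, hw, hwcl⟩ := ht htcd
      set η' := η / (4 + L) with hη'
      have h4L : 0 < 4 + L := by linarith
      have hη'0 : 0 < η' := div_pos hη h4L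
      obtain ⟨_, ⟨j, rfl⟩, hj⟩ := Metric.mem_closure_iff.1 hwcl η' hη'0
      rw [dist_eq_norm] at hj
      obtain ⟨h₀, hh₀, C, hC⟩ := hstep j
      have hlin : ∀ᶠ s in 𝓝[>] t, ‖u s - u t - (s - t) • w‖ ≤ η' * (s - t) := by
        have h1 := (hasDerivAt_iff_isLittleO.1 hw).def hη'0
        filter_upwards [h1.filter_mono nhdsWithin_le_nhds, self_mem_nhdsWithin]
          with s hs (hts : t < s)
        rwa [Real.norm_eq_abs, abs_of_pos (sub_pos.2 hts)] at hs
      have hlim : Tendsto (fun s => s - t) (𝓝[>] t) (𝓝 0) := by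
        have : Tendsto (fun s => s - t) (𝓝 t) (𝓝 (t - t)) :=
          (continuous_id.sub continuous_const).tendsto t
        rw [sub_self] at this
        exact this.mono_left nhdsWithin_le_nhds
      have hC' : ∀ᶠ s in 𝓝[>] t, C * (s - t) < η' := by
        have := hlim.const_mul C
        rw [mul_zero] at this
        exact this.eventually_lt_const hη'0
      have hr' : ∀ᶠ s in 𝓝[>] t, η' * (s - t) < r - δ t := by
        have := hlim.const_mul η'
        rw [mul_zero] at this
        exact this.eventually_lt_const (sub_pos.2 hrδ)
      filter_upwards [hlin, hC', hr', hlim.eventually_lt_const hh₀,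
        hlim.eventually_lt_const one_pos, self_mem_nhdsWithin]
        with s hs1 hs2 hs3 hs4 hs5 (hts : t < s)
      set h := s - t with hh
      have hpos : 0 < h := sub_pos.2 hts
      have htI : t ∈ Icc c d := Ioo_subset_Icc_self htcd
      obtain ⟨p, hp, hpd⟩ := (Metric.infDist_lt_iff (hneR t htI.1)).1
        (lt_add_of_pos_right (δ t) (mul_pos hη'0 hpos))
      rw [dist_comm, dist_eq_norm] at hpd
      have hpr : ‖p - u t‖ ≤ r := by linarith
      obtain ⟨q, hq, hqp⟩ := hC t htI p hp hpr h ⟨hpos.le, hs4.le⟩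
      rw [show t + h = s by simp [hh]] at hq
      have hY := hlip j t htI p hpr
      have hdist : δ s ≤ δ t * (1 + L * h) + η * h := by
        have hsplit : q - u s = (q - p - h • Y j p) + (p - u t) + h • (Y j p - Y j (u t)) +
            h • (Y j (u t) - w) - (u s - u t - h • w) := by
          simp only [smul_sub]; abel
        have hnorm : ‖q - u s‖ ≤ C * h ^ 2 + (δ t + η' * h) + h * (L * (δ t + η' * h)) +
            h * η' + η' * h := by
          rw [hsplit]
          refine (norm_sub_le _ _).trans (add_le_add ?_ hs1)
          refine (norm_add_le _ _).trans (add_le_add ?_ ?_)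
          · refine (norm_add_le _ _).trans (add_le_add ?_ ?_)
            · exact (norm_add_le _ _).trans (add_le_add hqp hpd.le)
            · rw [norm_smul, Real.norm_eq_abs, abs_of_pos hpos]
              exact mul_le_mul_of_nonneg_left
                (hY.trans (mul_le_mul_of_nonneg_left hpd.le hL)) hpos.le
          · rw [norm_smul, Real.norm_eq_abs, abs_of_pos hpos, norm_sub_rev]
            exact mul_le_mul_of_nonneg_left hj.le hpos.le
        have h1 : C * h ^ 2 ≤ η' * h := by
          rw [pow_two, ← mul_assoc]
          exact mul_le_mul_of_nonneg_right hs2.le hpos.le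
        have h2 : h * (L * (η' * h)) ≤ L * (η' * h) :=
          mul_le_of_le_one_left (by positivity) hs5.le
        have h3 : η * h = (4 + L) * (η' * h) := by
          rw [hη']; field_simp
        have h4 : δ s ≤ ‖q - u s‖ := by
          rw [← dist_eq_norm, dist_comm]
          exact Metric.infDist_le_dist_of_mem hq
        rw [h3]
        linarith [mul_add L (δ t) (η' * h), mul_add h (L * δ t) (L * (η' * h))]
      have h5 : F s ≤ Real.exp (-(L * (s - c))) * (δ t * (1 + L * h) + η * h) :=
        mul_le_mul_of_nonneg_left ((min_le_right _ _).trans hdist) (Real.exp_pos _).le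
      have h6 : Real.exp (-(L * (s - c))) * (1 + L * h) ≤ Real.exp (-(L * (t - c))) := by
        calc _ ≤ Real.exp (-(L * (s - c))) * Real.exp (L * h) := by
              gcongr; linarith [Real.add_one_le_exp (L * h)]
          _ = _ := by rw [← Real.exp_add]; congr 1; rw [hh]; ring
      have h7 : F t = Real.exp (-(L * (t - c))) * δ t := by
        simp only [hF, hD, min_eq_right hrδ.le]
      have h8 : Real.exp (-(L * (s - c))) * (η * h) ≤ η * h :=
        mul_le_of_le_one_left (mul_pos hη hpos).le (hexp s (htI.1.trans hts.le))
      have h9 := mul_le_mul_of_nonneg_right h6 (hδ0 t)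
      rw [h7]
      linarith
  have hfin := le_of_ae_dini_nonpos hcd hG hFG hdini
  have hc : F c ≤ δ c := by
    simp only [hF, sub_self, mul_zero, neg_zero, Real.exp_zero, one_mul]
    exact min_le_right _ _
  calc D d = Real.exp (L * (d - c)) * F d := by
        simp only [hF]
        rw [← mul_assoc, ← Real.exp_add, add_neg_cancel, Real.exp_zero, one_mul]
    _ ≤ _ := by gcongr; exact hfin.trans hc

section

variable {n : ℕ} {M : Type*} [TopologicalSpace M] [ChartedSpace (EuclideanSpace ℝ (Fin n)) M]
  [IsManifold (𝓡 n) ∞ M] [T2Space M] [SigmaCompactSpace M] {P : FibreSeminorm n M}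

open FibreSeminorm

/-- Within a chart where the Lipschitz seminorm condition holds, the endpoint of a subunit curve is
approximated by endpoints of piecewise flow curves of the same duration, starting at any point near
the initial point of the curve. -/
lemma exists_flowReach_of_chart {φ : OpenPartialHomeomorph M (EuclideanSpace ℝ (Fin n))}
    (hφ : φ ∈ IsManifold.maximalAtlas (𝓡 n) ∞ M) (htarget : φ.target = univ)
    {𝔛 : Set ((x : M) → TangentSpace (𝓡 n) x)} {L : ℝ}
    (h𝔛 : ∀ X ∈ 𝔛, P.IsSubunitFieldOn φ.source X)
    (hlip : ∀ X ∈ 𝔛, ∀ p ∈ Metric.ball (0 : EuclideanSpace ℝ (Fin n)) 1,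
      ∀ q ∈ Metric.ball (0 : EuclideanSpace ℝ (Fin n)) 1,
        ‖chartField φ X p - chartField φ X q‖ ≤ L * ‖p - q‖)
    (hdense : ∀ x ∈ φ.symm '' Metric.ball 0 1,
      closure ((fun X : (y : M) → TangentSpace (𝓡 n) y => X x) '' 𝔛) = {v | P.dual x v ≤ 1})
    {γ : ℝ → M} {c d : ℝ} (hcd : c ≤ d) (hγ : MapsTo γ (Icc c d) (φ.symm '' Metric.ball 0 1))
    (hac : AbsolutelyContinuousOnInterval (φ ∘ γ) c d)
    (hder : ∀ᵐ t, t ∈ Ioo c d → ∃ v : TangentSpace (𝓡 n) (γ t),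
      HasMFDerivAt 𝓘(ℝ, ℝ) (𝓡 n) γ t ((1 : ℝ →L[ℝ] ℝ).smulRight v) ∧ P.dual (γ t) v ≤ 1)
    {W : Set M} (hW : W ∈ 𝓝 (γ d)) :
    ∃ W' ∈ 𝓝 (γ c), ∀ x ∈ W', ∃ z ∈ W, P.FlowReach x z (d - c) := by
  set u := φ ∘ γ with hu
  set K := max L 0 with hK
  have hK0 : 0 ≤ K := le_max_right _ _
  have hlip' : ∀ X ∈ 𝔛, ∀ p ∈ Metric.ball (0 : EuclideanSpace ℝ (Fin n)) 1,
      ∀ q ∈ Metric.ball (0 : EuclideanSpace ℝ (Fin n)) 1,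
        ‖chartField φ X p - chartField φ X q‖ ≤ K * ‖p - q‖ := fun X hX p hp q hq =>
    (hlip X hX p hp q hq).trans (mul_le_mul_of_nonneg_right (le_max_left _ _) (norm_nonneg _))
  have hsrc : ∀ t ∈ Icc c d, γ t ∈ φ.source := by
    intro t ht
    obtain ⟨p, -, hp⟩ := hγ ht
    rw [← hp]
    exact φ.map_target (htarget ▸ mem_univ p)
  have huball : ∀ t ∈ Icc c d, u t ∈ Metric.ball (0 : EuclideanSpace ℝ (Fin n)) 1 := by
    intro t ht
    obtain ⟨p, hp, hp'⟩ := hγ ht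
    rw [hu, Function.comp_apply, ← hp', φ.right_inv (htarget ▸ mem_univ p)]
    exact hp
  have hsymm : ∀ t ∈ Icc c d, φ.symm (u t) = γ t := fun t ht => φ.left_inv (hsrc t ht)
  have hcI : c ∈ Icc c d := left_mem_Icc.2 hcd
  have hdI : d ∈ Icc c d := right_mem_Icc.2 hcd
  -- balls of radius `r = δ / 2` about points within `r` of `u` stay in the unit ball
  obtain ⟨δ, hδ, hthick⟩ : ∃ δ > 0, ∀ t ∈ Icc c d, Metric.closedBall (u t) δ ⊆ Metric.ball 0 1 := by
    have hcpt : IsCompact (u '' Icc c d) :=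
      isCompact_Icc.image_of_continuousOn (uIcc_of_le hcd ▸ hac.continuousOn)
    obtain ⟨δ, hδ, h⟩ := hcpt.exists_cthickening_subset_open Metric.isOpen_ball
      (image_subset_iff.2 huball)
    exact ⟨δ, hδ, fun t ht =>
      (Metric.closedBall_subset_cthickening (mem_image_of_mem u ht) δ).trans h⟩
  set r := δ / 2 with hr
  have hr0 : 0 < r := half_pos hδ
  have hnear : ∀ t ∈ Icc c d, ∀ p, ‖p - u t‖ ≤ r →
      Metric.closedBall p r ⊆ Metric.ball (0 : EuclideanSpace ℝ (Fin n)) 1 := by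
    intro t ht p hp
    refine Subset.trans (Metric.closedBall_subset_closedBall' ?_) (hthick t ht)
    rw [dist_eq_norm]
    linarith
  obtain ⟨ε, hε, hεW⟩ : ∃ ε > 0, ∀ q, dist q (u d) < ε → φ.symm q ∈ W := by
    have hcont : ContinuousAt φ.symm (u d) := φ.continuousAt_symm (htarget ▸ mem_univ _)
    have hW' : φ.symm ⁻¹' W ∈ 𝓝 (u d) := hcont (by rwa [hsymm d hdI])
    obtain ⟨ε, hε, h⟩ := Metric.mem_nhds_iff.1 hW'
    exact ⟨ε, hε, fun q hq => h hq⟩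
  set ε' := min ε r
  have hε' : 0 < ε' := lt_min hε hr0
  have hpos : 0 < ε' * Real.exp (-(K * (d - c))) := mul_pos hε' (Real.exp_pos _)
  refine ⟨φ.source ∩ φ ⁻¹' Metric.ball (u c) (ε' * Real.exp (-(K * (d - c)))), ?_, ?_⟩
  · exact inter_mem (φ.open_source.mem_nhds (hsrc c hcI))
      ((φ.continuousAt (hsrc c hcI)) (Metric.ball_mem_nhds _ hpos))
  rintro x ⟨hxs, hxd⟩
  -- coordinates of the points reached from `x` at time `t`
  set R : ℝ → Set (EuclideanSpace ℝ (Fin n)) := fun t =>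
    φ '' {z | z ∈ φ.source ∧ P.FlowReach x z (t - c)} with hR
  have hxR : φ x ∈ R c := ⟨x, ⟨hxs, by rw [sub_self]; exact FlowReach.refl⟩, rfl⟩
  have hmain := min_infDist_le_exp_mul hcd hac (R := R) ⟨_, hxR⟩
    (fun s t hs hst => image_mono fun z hz => ⟨hz.1, hz.2.mono (by linarith)⟩) hr0 hK0
    (Y := fun X : 𝔛 => chartField φ X) ?_ ?_ ?_
  · have h1 : Metric.infDist (u c) (R c) < ε' * Real.exp (-(K * (d - c))) := by
      refine (Metric.infDist_le_dist_of_mem hxR).trans_lt ?_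
      rw [dist_comm]; exact hxd
    have h2 : min r (Metric.infDist (u d) (R d)) < ε' := by
      refine hmain.trans_lt ?_
      calc _ < Real.exp (K * (d - c)) * (ε' * Real.exp (-(K * (d - c)))) := by gcongr
        _ = ε' * (Real.exp (K * (d - c)) * Real.exp (-(K * (d - c)))) := by ring
        _ = ε' := by rw [← Real.exp_add, add_neg_cancel, Real.exp_zero, mul_one]
    have h3 : Metric.infDist (u d) (R d) < ε' :=
      (min_lt_iff.1 h2).resolve_left (not_lt.2 (min_le_right _ _))
    have hRne : (R d).Nonempty := by
      obtain ⟨z, hz, -⟩ := hxR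
      exact ⟨φ z, z, ⟨hz.1, hz.2.mono (by linarith)⟩, rfl⟩
    obtain ⟨_, ⟨z, ⟨hzs, hz⟩, rfl⟩, hzd⟩ := (Metric.infDist_lt_iff hRne).1 h3
    refine ⟨z, ?_, hz⟩
    have := hεW (φ z) (by rw [dist_comm]; exact hzd.trans_le (min_le_left _ _))
    rwa [φ.left_inv hzs] at this
  · rintro ⟨X, hX⟩
    obtain ⟨X', hX', hXX'⟩ := (h𝔛 X hX).exists_global htarget
    set C := ‖chartField φ X 0‖ + K with hC
    have hC0 : 0 ≤ C := add_nonneg (norm_nonneg _) hK0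
    have hbd : ∀ q ∈ Metric.ball (0 : EuclideanSpace ℝ (Fin n)) 1, ‖chartField φ X q‖ ≤ C := by
      intro q hq
      have h1 := hlip' X hX q hq 0 (Metric.mem_ball_self one_pos)
      have h2 : K * ‖q - 0‖ ≤ K := by
        refine mul_le_of_le_one_right hK0 ?_
        rw [sub_zero]; exact (mem_ball_zero_iff.1 hq).le
      linarith [norm_le_norm_add_norm_sub' (chartField φ X q) (chartField φ X 0)]
    refine ⟨r / (C + 1), by positivity, K * C, ?_⟩
    rintro t ht _ ⟨z, ⟨hzs, hz⟩, rfl⟩ hp h ⟨hh0, hh⟩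
    have hball := hnear t ht _ hp
    have hCh : C * h ≤ r := by
      rw [le_div_iff₀ (by positivity)] at hh
      linarith
    obtain ⟨v, hv0, hvball, hv, hverr⟩ := exists_integralCurve_in_closedBall hr0.le hC0 hK0 hh0 hCh
      (fun q hq => hbd q (hball hq)) (fun q hq q' hq' => hlip' X hX q (hball hq) q' (hball hq'))
    have hint : IsMIntegralCurveOn (φ.symm ∘ v) X' (Icc 0 h) := by
      intro s hs
      rw [Function.comp_apply, hXX' _ (mem_image_of_mem φ.symm (hball (hvball s hs)))]
      exact hasMFDerivWithinAt_chart_symm_comp hφ (htarget ▸ mem_univ _) (hv s hs)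
    have hreach := FlowReach.single hh0 hX' hint
    simp only [Function.comp_apply, hv0, φ.left_inv hzs] at hreach
    refine ⟨v h, ⟨φ.symm (v h), ⟨φ.map_target (htarget ▸ mem_univ _), ?_⟩,
      φ.right_inv (htarget ▸ mem_univ _)⟩, hverr⟩
    rw [show t + h - c = t - c + h by ring]
    exact hz.trans hreach
  · rintro ⟨X, hX⟩ t ht p hp
    exact hlip' X hX p (hnear t ht p hp (Metric.mem_closedBall_self hr0.le)) (u t) (huball t ht)
  · filter_upwards [hder] with t ht htI
    have htI' := Ioo_subset_Icc_self htI
    obtain ⟨v, hv, hv1⟩ := ht htI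
    let w : EuclideanSpace ℝ (Fin n) := mfderiv (𝓡 n) (𝓡 n) φ (γ t) v
    refine ⟨w, hasDerivAt_chart_comp hφ (hsrc t htI') hv rfl, ?_⟩
    have hvcl : v ∈ closure ((fun X : (y : M) → TangentSpace (𝓡 n) y => X (γ t)) '' 𝔛) := by
      rw [hdense _ (hγ htI')]; exact hv1
    refine map_mem_closure (mfderiv (𝓡 n) (𝓡 n) φ (γ t)).continuous hvcl ?_
    rintro _ ⟨X, hX, rfl⟩
    refine ⟨⟨X, hX⟩, ?_⟩
    simp only [chartField]
    rw [hsymm t htI']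
    rfl

/-- Endpoints of subunit curves are approximated by endpoints of piecewise flow curves with the
same initial point and of the same duration. -/
lemma exists_flowReach_mem_of_isSubunitCurve (hP : P.LipschitzCondition) {γ : ℝ → M} {T : ℝ}
    (hT : 0 ≤ T) (hγ : P.IsSubunitCurve 0 T γ) {W : Set M} (hW : W ∈ 𝓝 (γ T)) :
    ∃ z ∈ W, P.FlowReach (γ 0) z T := by
  obtain ⟨A, ⟨-, hA, htarget, -, hcover⟩, hfields⟩ := hP
  obtain ⟨⟨hcont, hac⟩, hder⟩ := hγ
  rw [ae_restrict_iff' measurableSet_Icc] at hder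
  have hopen : ∀ φ : A, IsOpen (φ.1.symm '' Metric.ball 0 1) := fun φ =>
    φ.1.symm.isOpen_image_of_subset_source Metric.isOpen_ball (by simp [htarget φ.1 φ.2])
  obtain ⟨t, ht0, htmono, ⟨m, hm⟩, ht⟩ := exists_monotone_Icc_subset_open_cover_Icc hT
    (c := fun φ : A => (fun s : Icc (0 : ℝ) T => γ s) ⁻¹' (φ.1.symm '' Metric.ball 0 1))
    (fun φ => (hopen φ).preimage (continuousOn_iff_continuous_domRestrict.1 hcont))
    (by
      intro s _
      have : γ s ∈ ⋃ φ ∈ A, φ.symm '' Metric.ball 0 1 := hcover ▸ mem_univ _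
      obtain ⟨φ, hφ, hs⟩ := mem_iUnion₂.1 this
      exact mem_iUnion.2 ⟨⟨φ, hφ⟩, hs⟩)
  have key : ∀ i, ∀ W ∈ 𝓝 (γ (t i)), ∃ z ∈ W, P.FlowReach (γ 0) z (t i) := by
    intro i
    induction i with
    | zero =>
      intro W hW
      have h0 : ((t 0 : Icc (0 : ℝ) T) : ℝ) = 0 := by rw [ht0]
      rw [h0] at hW ⊢
      exact ⟨γ 0, mem_of_mem_nhds hW, FlowReach.refl⟩
    | succ i ih =>
      intro W hW
      obtain ⟨⟨φ, hφ⟩, hsub⟩ := ht i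
      obtain ⟨𝔛, L, -, h𝔛, hlip, hdense⟩ := hfields φ hφ
      have hle : (t i : ℝ) ≤ t (i + 1) := htmono i.le_succ
      have hIcc : Icc (t i : ℝ) (t (i + 1)) ⊆ Icc 0 T := Icc_subset_Icc (t i).2.1 (t (i + 1)).2.2
      have hmap : MapsTo γ (Icc (t i : ℝ) (t (i + 1))) (φ.symm '' Metric.ball 0 1) :=
        fun s hs => hsub (show (⟨s, hIcc hs⟩ : Icc (0 : ℝ) T) ∈ Icc (t i) (t (i + 1)) from hs)
      have hsrc : φ.symm '' Metric.ball 0 1 ⊆ φ.source := by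
        rintro _ ⟨p, -, rfl⟩
        exact φ.map_target (htarget φ hφ ▸ mem_univ p)
      obtain ⟨W', hW', hW'r⟩ := exists_flowReach_of_chart (hA hφ) (htarget φ hφ) h𝔛 hlip hdense hle
        hmap (hac φ (hA hφ) _ _ (t i).2.1 hle (t (i + 1)).2.2 (hmap.mono_right hsrc))
        (hder.mono fun s hs hs' => hs (hIcc (Ioo_subset_Icc_self hs'))) hW
      obtain ⟨y, hy, hyr⟩ := ih W' hW'
      obtain ⟨z, hz, hzr⟩ := hW'r y hy
      exact ⟨z, hz, by simpa using hyr.trans hzr⟩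
  have hTm : ((t m : Icc (0 : ℝ) T) : ℝ) = T := by rw [hm m le_rfl]
  have := key m W (by rwa [hTm])
  rwa [hTm] at this

/-- Arbitrarily close to `y` there are points `z ≠ y` whose flow distance from `x` is below any
given bound larger than `ϱ_P (x, y)`. -/
lemma frequently_rhoFlow_lt (hP : P.LipschitzCondition) {x y : M} (hxy : x ≠ y) {b : ℝ≥0∞}
    (hb : P.rho x y < b) : ∃ᶠ z in 𝓝[≠] y, P.rhoFlow x z < b := by
  obtain ⟨T, γ, hT, hγ, rfl, rfl, hTb⟩ := curveDist_lt_iff.1 hb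
  rw [frequently_nhdsWithin_iff, frequently_iff]
  intro U hU
  obtain ⟨V, hVU, hV, hyV⟩ := mem_nhds_iff.1 hU
  obtain ⟨z, hz, hzr⟩ := exists_flowReach_mem_of_isSubunitCurve hP hT.le hγ (hV.mem_nhds hyV)
  by_cases hzy : z = γ T
  · obtain ⟨z', hz', hne, hz'r⟩ := (hzy ▸ hzr).exists_ne_mem hxy (hV.mem_nhds hyV)
    exact ⟨z', hVU hz', (hz'r.rhoFlow_le hT).trans_lt hTb, hne⟩
  · exact ⟨z, hVU hz, (hzr.rhoFlow_le hT).trans_lt hTb, hzy⟩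

end

/-! ### Reparametrization of smooth subunit curves -/

/-- An injective function with nonvanishing derivative pulls null sets back to null sets. -/
lemma ae_notMem_of_hasDerivAt_ne_zero {θ θ' : ℝ → ℝ} {I N : Set ℝ} (hI : MeasurableSet I)
    (hcont : Continuous θ) (hθ' : Measurable θ') (hd : ∀ t ∈ I, HasDerivAt θ (θ' t) t)
    (hne : ∀ t ∈ I, θ' t ≠ 0) (hinj : InjOn θ I) (hN : volume N = 0) :
    ∀ᵐ t, t ∈ I → θ t ∉ N := by
  set A := I ∩ θ ⁻¹' toMeasurable volume N with hA
  have hAm : MeasurableSet A := hI.inter (hcont.measurable (measurableSet_toMeasurable _ _))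
  have hzero : ∫⁻ t in A, ENNReal.ofReal |θ' t| = 0 := by
    have h1 := lintegral_image_eq_lintegral_abs_deriv_mul hAm
      (fun t ht => (hd t ht.1).hasDerivWithinAt) (hinj.mono inter_subset_left) (fun _ => 1)
    simp only [mul_one, lintegral_const, Measure.restrict_apply MeasurableSet.univ, univ_inter,
      one_mul] at h1
    rw [← h1]
    refine measure_mono_null ?_ ((measure_toMeasurable N).trans hN)
    rintro _ ⟨t, ht, rfl⟩
    exact ht.2
  have hae := (lintegral_eq_zero_iff (by fun_prop)).1 hzero
  rw [EventuallyEq, ae_restrict_iff' hAm] at hae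
  filter_upwards [hae] with t ht htI htN
  have h0 := ht ⟨htI, subset_toMeasurable volume N htN⟩
  simp only [Pi.zero_apply, ENNReal.ofReal_eq_zero] at h0
  exact hne t htI (abs_eq_zero.1 (le_antisymm h0 (abs_nonneg _)))

/-- A smooth nondecreasing map onto `[0, T]`, with derivative at most `1`, which increases only
during the time interval `[0, T + ε]`. Its derivative is a normalized product of two smooth
transition functions. -/
lemma exists_smooth_slowdown {T ε : ℝ} (hT : 0 < T) (hε : 0 < ε) :
    ∃ θ : ℝ → ℝ, ContDiff ℝ ∞ θ ∧ (∀ t ≤ 0, θ t = 0) ∧ (∀ t, T + ε ≤ t → θ t = T) ∧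
      (∀ t, θ t ∈ Icc 0 T) ∧ (∀ t, |deriv θ t| ≤ 1) ∧ ∀ t ∈ Ioo 0 (T + ε), 0 < deriv θ t := by
  set κ := ε / 2 with hκ
  have hκ0 : 0 < κ := half_pos hε
  set β : ℝ → ℝ := fun t =>
    Real.smoothTransition (t / κ) * Real.smoothTransition ((T + ε - t) / κ) with hβ
  have hβs : ContDiff ℝ ∞ β :=
    (Real.smoothTransition.contDiff.comp (contDiff_id.div_const κ)).mul
      (Real.smoothTransition.contDiff.comp ((contDiff_const.sub contDiff_id).div_const κ))
  have hβc : Continuous β := hβs.continuous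
  have hβi : ∀ a b, IntervalIntegrable β volume a b := fun a b => hβc.intervalIntegrable a b
  have hβ0 : ∀ t, 0 ≤ β t := fun t =>
    mul_nonneg (Real.smoothTransition.nonneg _) (Real.smoothTransition.nonneg _)
  have hβ1 : ∀ t, β t ≤ 1 := fun t =>
    mul_le_one₀ (Real.smoothTransition.le_one _) (Real.smoothTransition.nonneg _)
      (Real.smoothTransition.le_one _)
  have hβpos : ∀ t ∈ Ioo 0 (T + ε), 0 < β t := fun t ht =>
    mul_pos (Real.smoothTransition.pos_of_pos (div_pos ht.1 hκ0))
      (Real.smoothTransition.pos_of_pos (div_pos (sub_pos.2 ht.2) hκ0))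
  have hβl : ∀ t ≤ 0, β t = 0 := fun t ht => by
    simp [hβ, Real.smoothTransition.zero_of_nonpos (div_nonpos_of_nonpos_of_nonneg ht hκ0.le)]
  have hβr : ∀ t, T + ε ≤ t → β t = 0 := fun t ht => by
    simp [hβ, Real.smoothTransition.zero_of_nonpos
      (div_nonpos_of_nonpos_of_nonneg (sub_nonpos.2 ht) hκ0.le)]
  -- `β = 1` on an interval of length `T`, so normalizing its integral to `T` does not increase it
  set I := ∫ v in (0 : ℝ)..(T + ε), β v with hI
  have hIT : T ≤ I := by
    have hone : ∀ v ∈ uIcc κ (T + κ), β v = 1 := by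
      intro v hv
      rw [uIcc_of_le (by linarith)] at hv
      simp only [hβ]
      rw [Real.smoothTransition.one_of_one_le ((one_le_div hκ0).2 hv.1),
        Real.smoothTransition.one_of_one_le ((one_le_div hκ0).2 (by linarith [hv.2])), one_mul]
    calc T = ∫ v in κ..(T + κ), β v := by
          rw [intervalIntegral.integral_congr hone]; simp
      _ ≤ I := intervalIntegral.integral_mono_interval hκ0.le (by linarith) (by linarith)
          (Eventually.of_forall hβ0) (hβi _ _)
  have hI0 : 0 < I := hT.trans_le hIT
  have hc0 : 0 < T / I := div_pos hT hI0
  have hc1 : T / I ≤ 1 := (div_le_one hI0).2 hIT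
  set θ : ℝ → ℝ := fun t => T / I * ∫ v in (0 : ℝ)..t, β v with hθ
  have hder : ∀ t, HasDerivAt θ (T / I * β t) t := fun t =>
    (intervalIntegral.integral_hasDerivAt_right (hβi _ _)
      (hβc.stronglyMeasurableAtFilter _ _) hβc.continuousAt).const_mul _
  have hderiv : deriv θ = fun t => T / I * β t := funext fun t => (hder t).deriv
  have hleft : ∀ t ≤ 0, θ t = 0 := by
    intro t ht
    have : ∫ v in (0 : ℝ)..t, β v = ∫ v in (0 : ℝ)..t, (0 : ℝ) :=
      intervalIntegral.integral_congr fun v hv => by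
        rw [uIcc_of_ge ht] at hv
        exact hβl v hv.2
    simp only [hθ, this]; simp
  have hright : ∀ t, T + ε ≤ t → θ t = T := by
    intro t ht
    have h0 : ∫ v in (T + ε)..t, β v = ∫ v in (T + ε)..t, (0 : ℝ) :=
      intervalIntegral.integral_congr fun v hv => by
        rw [uIcc_of_le ht] at hv
        exact hβr v hv.1
    simp only [hθ]
    rw [← intervalIntegral.integral_add_adjacent_intervals (hβi 0 (T + ε)) (hβi _ t), h0]
    simp only [intervalIntegral.integral_zero, add_zero]
    exact div_mul_cancel₀ T hI0.ne'
  have hmono : Monotone θ := monotone_of_deriv_nonneg (fun t => (hder t).differentiableAt)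
    fun t => by rw [hderiv]; exact mul_nonneg hc0.le (hβ0 t)
  refine ⟨θ, ?_, hleft, hright, fun t => ⟨?_, ?_⟩, fun t => ?_, fun t ht => ?_⟩
  · refine contDiff_infty_iff_deriv.2 ⟨fun t => (hder t).differentiableAt, ?_⟩
    rw [hderiv]
    exact contDiff_const.mul hβs
  · rw [← hleft (min t 0) (min_le_right _ _)]; exact hmono (min_le_left _ _)
  · rw [← hright (max t (T + ε)) (le_max_right _ _)]; exact hmono (le_max_left _ _)
  · rw [hderiv, abs_of_nonneg (mul_nonneg hc0.le (hβ0 t))]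
    exact mul_le_one₀ hc1 (hβ0 t) (hβ1 t)
  · rw [hderiv]; exact mul_pos hc0 (hβpos t ht)

section

variable {n : ℕ} {M : Type*} [TopologicalSpace M] [ChartedSpace (EuclideanSpace ℝ (Fin n)) M]

lemma IsSmoothCurve.isACCurve {a b : ℝ} {γ : ℝ → M} (hγ : IsSmoothCurve n a b γ) :
    IsACCurve n a b γ := by
  refine ⟨hγ.continuousOn, fun φ hφ c d hac hcd hdb hmap => ?_⟩
  have h1 : ContMDiffOn 𝓘(ℝ, ℝ) (𝓡 n) ∞ (φ ∘ γ) (Icc c d) :=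
    (contMDiffOn_of_mem_maximalAtlas hφ).comp (hγ.mono (Icc_subset_Icc hac hdb)) hmap
  have h2 : ContDiffOn ℝ 1 (φ ∘ γ) (uIcc c d) := by
    rw [uIcc_of_le hcd]
    exact (contMDiffOn_iff_contDiffOn.1 h1).of_le (by simp)
  exact h2.absolutelyContinuousOnInterval

variable [IsManifold (𝓡 n) ∞ M]

namespace FibreSeminorm

/-- The velocity of `γ` at time `t` exists and is `P`-subunit. -/
def HasSubunitVelocity (P : FibreSeminorm n M) (γ : ℝ → M) (t : ℝ) : Prop :=
  ∃ v : TangentSpace (𝓡 n) (γ t),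
    HasMFDerivAt 𝓘(ℝ, ℝ) (𝓡 n) γ t ((1 : ℝ →L[ℝ] ℝ).smulRight v) ∧ P.dual (γ t) v ≤ 1

variable {P : FibreSeminorm n M}

lemma isSmoothSubunitCurve_iff {a b : ℝ} {γ : ℝ → M} :
    P.IsSmoothSubunitCurve a b γ ↔
      IsSmoothCurve n a b γ ∧ ∀ᵐ t, t ∈ Ioo a b → P.HasSubunitVelocity γ t := by
  have hae : (∀ᵐ t ∂(volume.restrict (Icc a b)), P.HasSubunitVelocity γ t) ↔
      ∀ᵐ t, t ∈ Ioo a b → P.HasSubunitVelocity γ t := by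
    rw [← ae_restrict_iff' measurableSet_Ioo, restrict_Ioo_eq_restrict_Icc]
  rw [← hae]
  exact ⟨fun h => ⟨h.1, h.2.2⟩, fun h => ⟨h.1, h.1.isACCurve, h.2⟩⟩

lemma HasSubunitVelocity.congr {γ σ : ℝ → M} {t : ℝ} (h : P.HasSubunitVelocity γ t)
    (hσ : σ =ᶠ[𝓝 t] γ) : P.HasSubunitVelocity σ t := by
  obtain ⟨v, hv, hv1⟩ := h
  have := hv.congr_of_eventuallyEq hσ
  have ht : γ t = σ t := hσ.eq_of_nhds.symm
  unfold HasSubunitVelocity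
  rw [← ht]
  exact ⟨v, this, hv1⟩

lemma HasSubunitVelocity.comp {γ : ℝ → M} {θ : ℝ → ℝ} {t κ : ℝ}
    (h : P.HasSubunitVelocity γ (θ t)) (hθ : HasDerivAt θ κ t) (hκ : |κ| ≤ 1) :
    P.HasSubunitVelocity (γ ∘ θ) t := by
  obtain ⟨v, hv, hv1⟩ := h
  refine ⟨κ • v, ?_, dual_smul_le hκ hv1⟩
  have h1 : HasMFDerivAt 𝓘(ℝ, ℝ) 𝓘(ℝ, ℝ) θ t ((1 : ℝ →L[ℝ] ℝ).smulRight κ) :=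
    hθ.hasFDerivAt.hasMFDerivAt
  have h2 := hv.comp t h1
  have h3 : (1 : ℝ →L[ℝ] ℝ).smulRight (κ • v) =
      ((1 : ℝ →L[ℝ] ℝ).smulRight v).comp ((1 : ℝ →L[ℝ] ℝ).smulRight κ) := by
    refine ContinuousLinearMap.ext fun r => ?_
    exact smul_smul r κ v
  rw [h3]
  exact h2

variable (P) in
lemma hasSubunitVelocity_const (x : M) (t : ℝ) : P.HasSubunitVelocity (fun _ => x) t := by
  refine ⟨0, ?_, P.dual_zero_le x⟩
  have := hasMFDerivAt_const (I := 𝓘(ℝ, ℝ)) (I' := 𝓡 n) (c := x) (x := t)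
  rwa [show (0 : TangentSpace 𝓘(ℝ, ℝ) t →L[ℝ] TangentSpace (𝓡 n) x) =
    (1 : ℝ →L[ℝ] ℝ).smulRight (0 : TangentSpace (𝓡 n) x) from
      (ContinuousLinearMap.smulRight_zero _).symm] at this

/-- Reparametrizations of smooth subunit curves which do not increase the speed are subunit. -/
lemma IsSmoothSubunitCurve.comp {a b a' b' : ℝ} {γ : ℝ → M} (hγ : P.IsSmoothSubunitCurve a b γ)
    {θ : ℝ → ℝ} (hθ : ContDiff ℝ ∞ θ) (hmap : MapsTo θ (Icc a' b') (Icc a b))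
    (hle : ∀ t, |deriv θ t| ≤ 1) (hne : ∀ t ∈ Ioo a' b', deriv θ t ≠ 0)
    (hinj : InjOn θ (Ioo a' b')) : P.IsSmoothSubunitCurve a' b' (γ ∘ θ) := by
  refine isSmoothSubunitCurve_iff.2 ⟨hγ.1.comp hθ.contMDiff.contMDiffOn hmap, ?_⟩
  have hd : ∀ t, HasDerivAt θ (deriv θ t) t := fun t =>
    (hθ.differentiable (by simp) t).hasDerivAt
  have hN := (ae_restrict_iff' measurableSet_Icc).1 hγ.2.2
  filter_upwards [ae_notMem_of_hasDerivAt_ne_zero measurableSet_Ioo hθ.continuous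
    (measurable_deriv θ) (fun t _ => hd t) hne hinj hN] with t ht htI
  have hgood := not_not.1 (ht htI) (hmap (Ioo_subset_Icc_self htI))
  exact HasSubunitVelocity.comp hgood (hd t) (hle t)

lemma IsSmoothSubunitCurve.comp_add {a b r : ℝ} {γ : ℝ → M}
    (hγ : P.IsSmoothSubunitCurve a b γ) {a' b' : ℝ} (ha : a ≤ a' + r) (hb : b' + r ≤ b) :
    P.IsSmoothSubunitCurve a' b' (fun t => γ (t + r)) := by
  refine hγ.comp (θ := fun t => t + r) (contDiff_id.add contDiff_const)
    (fun t ht => ⟨by linarith [ht.1], by linarith [ht.2]⟩) ?_ ?_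
    (add_left_injective r).injOn <;> simp

lemma IsSmoothSubunitCurve.reverse {T : ℝ} {γ : ℝ → M} (hγ : P.IsSmoothSubunitCurve 0 T γ) :
    P.IsSmoothSubunitCurve 0 T (fun t => γ (T - t)) := by
  refine hγ.comp (θ := fun t => T - t) (contDiff_const.sub contDiff_id)
    (fun t ht => ⟨by linarith [ht.2], by linarith [ht.1]⟩) (by simp) (by simp)
    sub_right_injective.injOn

/-- Smooth subunit curves can be concatenated at the cost of an arbitrarily small delay: both
curves are slowed down near the junction until they are constant there. -/
lemma IsSmoothSubunitCurve.exists_concat {T S ε : ℝ} {γ σ : ℝ → M} (hT : 0 < T) (hS : 0 < S)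
    (hε : 0 < ε) (hγ : P.IsSmoothSubunitCurve 0 T γ) (hσ : P.IsSmoothSubunitCurve 0 S σ)
    (hγσ : γ T = σ 0) : ∃ τ : ℝ → M, P.IsSmoothSubunitCurve 0 (T + S + ε) τ ∧
      τ 0 = γ 0 ∧ τ (T + S + ε) = σ S := by
  have hε3 : 0 < ε / 3 := by positivity
  have key : ∀ {T : ℝ} {γ : ℝ → M}, 0 < T → P.IsSmoothSubunitCurve 0 T γ →
      ∃ ρ : ℝ → M, ContMDiff 𝓘(ℝ, ℝ) (𝓡 n) ∞ ρ ∧ (∀ t ≤ 0, ρ t = γ 0) ∧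
        (∀ t, T + ε / 3 ≤ t → ρ t = γ T) ∧
        ∀ᵐ t, t ∈ Ioo 0 (T + ε / 3) → P.HasSubunitVelocity ρ t := by
    intro T γ hT hγ
    obtain ⟨θ, hθ, hl, hr, hmem, hle, hpos⟩ := exists_smooth_slowdown hT hε3
    refine ⟨γ ∘ θ, ?_, fun t ht => ?_, fun t ht => ?_, ?_⟩
    · exact contMDiffOn_univ.1 (hγ.1.comp hθ.contMDiff.contMDiffOn fun t _ => hmem t)
    · simp only [Function.comp_apply, hl t ht]
    · simp only [Function.comp_apply, hr t ht]
    · have hmono : StrictMonoOn θ (Ioo 0 (T + ε / 3)) :=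
        strictMonoOn_of_deriv_pos (convex_Ioo _ _) hθ.continuous.continuousOn
          (by rw [interior_Ioo]; exact hpos)
      exact (isSmoothSubunitCurve_iff.1 (hγ.comp hθ (fun t _ => hmem t) hle
        (fun t ht => (hpos t ht).ne') hmono.injOn)).2
  obtain ⟨ρ₁, hs₁, hl₁, hr₁, hv₁⟩ := key hT hγ
  obtain ⟨ρ₂, hs₂, hl₂, hr₂, hv₂⟩ := key hS hσ
  -- the first curve rests from time `T + ε / 3` on, and the second one starts at time `m`
  set m := T + ε / 3 + ε / 3 with hm
  set τ : ℝ → M := fun t => if t < m then ρ₁ t else ρ₂ (t - m) with hτ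
  have hleft : ∀ t < m, τ t = ρ₁ t := fun t ht => if_pos ht
  have hright : ∀ t, T + ε / 3 ≤ t → τ t = ρ₂ (t - m) := by
    intro t ht
    by_cases htm : t < m
    · rw [hleft t htm, hr₁ t ht, hl₂ _ (by linarith), hγσ]
    · exact if_neg htm
  have hleft' : ∀ t < m, τ =ᶠ[𝓝 t] ρ₁ := fun t ht =>
    (eventually_lt_nhds ht).mono hleft
  have hright' : ∀ t, T + ε / 3 < t → τ =ᶠ[𝓝 t] ρ₂ ∘ (fun t => t - m) := fun t ht =>
    (eventually_gt_nhds ht).mono fun s hs => hright s (le_of_lt hs)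
  have hshift : ContMDiff 𝓘(ℝ, ℝ) (𝓡 n) ∞ (ρ₂ ∘ fun t => t - m) :=
    hs₂.comp (contDiff_id.sub contDiff_const).contMDiff
  have hsmooth : ContMDiff 𝓘(ℝ, ℝ) (𝓡 n) ∞ τ := by
    intro t
    rcases lt_or_ge t m with ht | ht
    · exact (hs₁ t).congr_of_eventuallyEq (hleft' t ht)
    · exact (hshift t).congr_of_eventuallyEq (hright' t (by linarith))
  have hv₂' : ∀ᵐ t, t - m ∈ Ioo 0 (S + ε / 3) → P.HasSubunitVelocity ρ₂ (t - m) :=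
    (measurePreserving_sub_right volume m).quasiMeasurePreserving.ae hv₂
  have hends : ∀ᵐ t : ℝ, t ∉ ({T + ε / 3, m} : Set ℝ) :=
    (Set.toFinite ({T + ε / 3, m} : Set ℝ)).countable.ae_notMem volume
  refine ⟨τ, isSmoothSubunitCurve_iff.2 ⟨hsmooth.contMDiffOn, ?_⟩, ?_, ?_⟩
  · filter_upwards [hv₁, hv₂', hends] with t ht₁ ht₂ htn htI
    simp only [mem_insert_iff, mem_singleton_iff, not_or] at htn
    rcases lt_or_gt_of_ne htn.1 with h | h
    · exact (ht₁ ⟨htI.1, h⟩).congr (hleft' t (by linarith))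
    · rcases lt_or_gt_of_ne htn.2 with h' | h'
      · refine (P.hasSubunitVelocity_const (γ T) t).congr ?_
        filter_upwards [eventually_gt_nhds h, eventually_lt_nhds h'] with s hs hs'
        rw [hleft s hs', hr₁ s (le_of_lt hs)]
      · refine HasSubunitVelocity.congr ?_ (hright' t h)
        refine (ht₂ ⟨by linarith, by linarith [htI.2]⟩).comp (κ := 1) (θ := fun t => t - m) ?_ ?_
        · exact (hasDerivAt_id t).sub_const m
        · simp
  · rw [hleft 0 (by positivity), hl₁ 0 le_rfl]
  · rw [hright _ (by linarith), hr₂ _ (by linarith)]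

/-! ### Comparison of the distances -/

variable (P)

lemma isSmoothSubunitCurve_const (a b : ℝ) (x : M) : P.IsSmoothSubunitCurve a b (fun _ => x) :=
  isSmoothSubunitCurve_iff.2 ⟨contMDiffOn_const,
    Eventually.of_forall fun t _ => P.hasSubunitVelocity_const x t⟩

lemma rhoSmooth_self (x : M) : P.rhoSmooth x x = 0 :=
  curveDist_self fun T _ => ⟨fun _ => x, P.isSmoothSubunitCurve_const 0 T x, rfl, rfl⟩

lemma rhoSmooth_triangle (x y z : M) :
    P.rhoSmooth x z ≤ P.rhoSmooth x y + P.rhoSmooth y z :=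
  curveDist_triangle (fun _ _ _ _ _ hT hS hε hγ hσ h => hγ.exists_concat hT hS hε hσ h) x y z

lemma rhoSmooth_comm (x y : M) : P.rhoSmooth x y = P.rhoSmooth y x :=
  curveDist_comm (fun T γ _ hγ => ⟨fun t => γ (T - t), hγ.reverse, by simp, by simp⟩) x y

lemma rho_le_rhoSmooth (x y : M) : P.rho x y ≤ P.rhoSmooth x y :=
  curveDist_mono (fun _ _ _ h => h.2) x y

lemma rho_self (x : M) : P.rho x x = 0 :=
  le_antisymm ((P.rho_le_rhoSmooth x x).trans (P.rhoSmooth_self x).le) bot_le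

variable {P}

lemma FlowReach.rhoSmooth_le {x y : M} {T : ℝ} (h : P.FlowReach x y T) :
    P.rhoSmooth x y ≤ ENNReal.ofReal T := by
  induction h with
  | refl => rw [P.rhoSmooth_self]; exact bot_le
  | @step T h X γ hr hh hX hγ ih =>
    rw [ENNReal.ofReal_add hr.nonneg hh]
    refine (P.rhoSmooth_triangle x (γ 0) (γ h)).trans (add_le_add ih ?_)
    rcases hh.eq_or_lt with rfl | hpos
    · rw [P.rhoSmooth_self]; exact bot_le
    · refine curveDist_le hpos (isSmoothSubunitCurve_iff.2
        ⟨isSmoothCurve_of_isMIntegralCurveOn hX.1 hγ, Eventually.of_forall fun t ht => ?_⟩)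
      exact ⟨X (γ t), (hγ t (Ioo_subset_Icc_self ht)).hasMFDerivAt (Icc_mem_nhds ht.1 ht.2),
        hX.2 _ (mem_univ _)⟩

variable (P)

lemma rhoSmooth_le_rhoFlow (x y : M) : P.rhoSmooth x y ≤ P.rhoFlow x y := by
  refine le_of_forall_gt fun b hb => ?_
  obtain ⟨T, γ, hT, hγ, rfl, rfl, hTb⟩ := curveDist_lt_iff.1 hb
  have := hγ.flowReach.rhoSmooth_le
  rw [sub_zero] at this
  exact this.trans_lt hTb

lemma rho_le_rhoFlow (x y : M) : P.rho x y ≤ P.rhoFlow x y :=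
  (P.rho_le_rhoSmooth x y).trans (P.rhoSmooth_le_rhoFlow x y)

/-- A varietal distance `ϱ` lying between `ϱ_P` and `ϱ_P^flow` agrees with `ϱ_P`: by lower
semicontinuity, `ϱ_P (x, y)` nearly bounds `ϱ_P^flow (x, z)` for some `z` near `y`, and `ϱ (z, y)`
is small. -/
lemma rho_eq_of_isVarietal [T2Space M] [SigmaCompactSpace M] (hP : P.LipschitzCondition)
    {ϱ : M → M → ℝ≥0∞} (hϱ : IsVarietal ϱ) (hle : ∀ x y, P.rho x y ≤ ϱ x y)
    (hflow : ∀ x y, ϱ x y ≤ P.rhoFlow x y) (hself : ∀ x, ϱ x x = 0)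
    (htri : ∀ x y z, ϱ x z ≤ ϱ x y + ϱ y z) (hcomm : ∀ x y, ϱ x y = ϱ y x) : P.rho = ϱ := by
  funext x y
  refine le_antisymm (hle x y) ?_
  by_cases hxy : x = y
  · rw [hxy, hself]; exact bot_le
  refine le_of_forall_gt_imp_ge_of_dense fun b hb => ?_
  refine ENNReal.le_of_forall_pos_le_add fun ε hε _ => ?_
  have hball : ∀ᶠ z in 𝓝[≠] y, ϱ y z < ε :=
    mem_nhdsWithin_of_mem_nhds (hϱ.ball_mem_nhds hself htri y (ENNReal.coe_pos.2 hε))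
  obtain ⟨z, hz, hzy⟩ := ((frequently_rhoFlow_lt hP hxy hb).and_eventually hball).exists
  calc ϱ x y ≤ ϱ x z + ϱ z y := htri x z y
    _ ≤ b + ε := add_le_add ((hflow x z).trans hz.le) (by rw [hcomm]; exact le_of_lt hzy)

/-! ### Length -/

variable {P}

lemma IsSmoothSubunitCurve.rho_le {T r s : ℝ} {γ : ℝ → M} (hγ : P.IsSmoothSubunitCurve 0 T γ)
    (hr : 0 ≤ r) (hrs : r ≤ s) (hs : s ≤ T) : P.rho (γ r) (γ s) ≤ ENNReal.ofReal (s - r) := by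
  rcases hrs.eq_or_lt with rfl | hlt
  · rw [P.rho_self]; exact bot_le
  · have h1 := hγ.comp_add (a' := 0) (b' := s - r) (r := r) (by simpa using hr) (by simpa using hs)
    have h2 := (P.rho_le_rhoSmooth _ _).trans (curveDist_le (sub_pos.2 hlt) h1)
    simpa using h2

lemma rho_le_length {a b : ℝ} (hab : a ≤ b) (γ : ℝ → M) :
    P.rho (γ a) (γ b) ≤ P.length a b γ := by
  let t : ℕ → ℝ := fun i => if i = 0 then a else b
  have ht : Monotone t ∧ t 0 = a ∧ t 1 = b := by
    refine ⟨monotone_nat_of_le_succ fun i => ?_, by simp [t], by simp [t]⟩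
    by_cases hi : i = 0 <;> simp [t, hi, hab]
  refine le_trans (le_of_eq ?_) (le_iSup₂_of_le 1 t (le_iSup_of_le ht le_rfl))
  simp [ht.2.1, ht.2.2]

lemma IsSmoothSubunitCurve.length_comp_le {T a b : ℝ} {γ : ℝ → M}
    (hγ : P.IsSmoothSubunitCurve 0 T γ) {θ : ℝ → ℝ} (hθ : Monotone θ) (ha : θ a = 0)
    (hb : θ b = T) : P.length a b (γ ∘ θ) ≤ ENNReal.ofReal T := by
  refine iSup₂_le fun m t => iSup_le ?_
  rintro ⟨ht, rfl, rfl⟩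
  have hmono : Monotone (θ ∘ t) := hθ.comp ht
  calc _ ≤ ∑ i ∈ Finset.range m, ENNReal.ofReal (θ (t (i + 1)) - θ (t i)) := by
        refine Finset.sum_le_sum fun i hi => hγ.rho_le ?_ (hmono i.le_succ) ?_
        · rw [← ha]; exact hmono (Nat.zero_le i)
        · rw [← hb]; exact hmono (Nat.succ_le_of_lt (Finset.mem_range.1 hi))
    _ = ENNReal.ofReal (∑ i ∈ Finset.range m, (θ (t (i + 1)) - θ (t i))) :=
        (ENNReal.ofReal_sum_of_nonneg fun i _ => sub_nonneg.2 (hmono i.le_succ)).symm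
    _ = ENNReal.ofReal T := by
        rw [Finset.sum_range_sub (fun i => θ (t i)), ha, hb, sub_zero]

variable (P)

/-- Where smooth subunit curves compute `ϱ_P`, so do the lengths of smooth curves: an affine
change of parameter turns a subunit curve of duration `T` into one on `[a, b]` of length at most
`T`. -/
lemma rho_eq_sInf_length (h : P.rho = P.rhoSmooth) {a b : ℝ} (hab : a < b) (x y : M) :
    P.rho x y = sInf {ℓ | ∃ γ : ℝ → M,
      IsSmoothCurve n a b γ ∧ γ a = x ∧ γ b = y ∧ ℓ = P.length a b γ} := by
  refine le_antisymm (le_sInf ?_) (le_of_forall_gt_imp_ge_of_dense fun c hc => ?_)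
  · rintro _ ⟨γ, -, rfl, rfl, rfl⟩
    exact rho_le_length hab.le γ
  · rw [h] at hc
    obtain ⟨T, γ, hT, hγ, rfl, rfl, hTc⟩ := curveDist_lt_iff.1 hc
    have hba : 0 < b - a := sub_pos.2 hab
    set θ : ℝ → ℝ := fun t => (t - a) * (T / (b - a)) with hθ
    have hmono : Monotone θ := fun s t hst =>
      mul_le_mul_of_nonneg_right (by linarith) (div_pos hT hba).le
    have ha : θ a = 0 := by simp [hθ]
    have hb : θ b = T := by simp only [hθ]; field_simp
    have hsm : ContDiff ℝ ∞ θ := (contDiff_id.sub contDiff_const).mul contDiff_const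
    have hsmooth : IsSmoothCurve n a b (γ ∘ θ) := hγ.1.comp hsm.contMDiff.contMDiffOn fun t ht =>
      ⟨ha ▸ hmono ht.1, hb ▸ hmono ht.2⟩
    exact le_trans (sInf_le ⟨γ ∘ θ, hsmooth, by rw [Function.comp_apply, ha],
      by rw [Function.comp_apply, hb], rfl⟩) ((hγ.length_comp_le hmono ha hb).trans hTc.le)

end FibreSeminorm

end

end SubFinsler

theorem mainTheorem6 {n : ℕ} {M : Type*} [TopologicalSpace M] [T2Space M] [SigmaCompactSpace M]
    [ChartedSpace (EuclideanSpace ℝ (Fin n)) M] [IsManifold (𝓡 n) ∞ M]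
    (P : SubFinsler.FibreSeminorm n M) (hP : P.LipschitzCondition) :
    (∀ x y : M, x ≠ y →
      Filter.liminf (fun z => P.rhoFlow x z) (𝓝[≠] y) ≤ P.rho x y) ∧
    (SubFinsler.IsVarietal P.rhoFlow → P.rho = P.rhoFlow) ∧
    (SubFinsler.IsVarietal P.rhoSmooth →
      P.rho = P.rhoSmooth ∧
      ∀ (a b : ℝ), a < b → ∀ x y : M,
        P.rho x y = sInf {ℓ | ∃ γ : ℝ → M,
          SubFinsler.IsSmoothCurve n a b γ ∧ γ a = x ∧ γ b = y ∧ ℓ = P.length a b γ}) := by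
  refine ⟨fun x y hxy => ?_, fun hvar => ?_, fun hvar => ?_⟩
  · refine le_of_forall_gt_imp_ge_of_dense fun b hb => ?_
    exact Filter.liminf_le_of_frequently_le
      ((SubFinsler.frequently_rhoFlow_lt hP hxy hb).mono fun z hz => hz.le)
  · exact P.rho_eq_of_isVarietal hP hvar P.rho_le_rhoFlow (fun _ _ => le_rfl) P.rhoFlow_self
      P.rhoFlow_triangle P.rhoFlow_comm
  · have h := P.rho_eq_of_isVarietal hP hvar P.rho_le_rhoSmooth P.rhoSmooth_le_rhoFlow
      P.rhoSmooth_self P.rhoSmooth_triangle P.rhoSmooth_comm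
    exact ⟨h, fun a b hab x y => P.rho_eq_sInf_length h hab x y⟩
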